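/- Let $A$ be a positive definite selfadjoint operator in a complex Hilbert space $\mathcal H_0$ with inner product $\langle\cdot,\cdot\rangle$ and norm $\|\cdot\|_0$ (positive definite: $\langle Au,u\rangle\ge\alpha\|u\|_0^2$ on $\mathcal D(A)$ for some $\alpha>0$). For $\tau\ge 0$ let $\mathcal H_\tau=\mathcal D(A^\tau)$ with inner product $\langle u,v\rangle_\tau=\langle A^\tau u,A^\tau v\rangle$ and norm $\|v\|_\tau=\|A^\tau v\|_0$. Let $\mathcal G_0$ be a Hilbert space consisting of the same elements as $\mathcal H_0$, with an equivalent norm $|\cdot|_0$, and let $M$ be a positive definite selfadjoint operator in $\mathcal G_0$ with compact inverse, with eigenvalues $0<\mu_1\le\mu_2\le\dots\to\infty$, counted according to multiplicity, and corresponding eigenvectors $q_1,q_2,\dots$ orthonormal in $\mathcal G_0$. Let $P_{n,1}$ be the orthogonal projection in $\mathcal H_1$ onto $\mathrm{span}\{q_1,\dots,q_n\}$. Assume that $\mathcal D(A^{3/2})=\mathcal D(M^{3/2})$ with equivalent norms $\|A^{3/2}v\|_0$ and $|M^{3/2}v|_0$. (Then $A$ has compact inverse, and all the $q_k$ lie in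 $\mathcal D(A)$.) Let $\lambda_1\le\lambda_2\le\dots$ be the eigenvalues of $A$, counted according to multiplicity, with corresponding eigenvectors $u_1,u_2,\dots$ orthonormal in $\mathcal H_0$. Let $\sigma\ge1$. (i) If $v\in\mathcal D(M^\sigma)$, then $v\in\mathcal D(A)$ and $$\|v-P_{n,1}v\|_{1/2}^2=o(\mu_{n+1}^{1-2\sigma})\quad\text{as } n\to\infty.$$ (ii) For each $n$ let $\Lambda_1^{(n,1)}\le\dots\le\Lambda_n^{(n,1)}$ be the harmonic Ritz values of $A$ for the trial vectors $q_1,\dots,q_n$, that is, the eigenvalues of the generalized matrix eigenvalue problem $$\big[\langle q_i,q_k\rangle_1\big]\,\mathbf x=\Lambda\,\big[\langle A^{-1}q_i,q_k\rangle_1\big]\,\mathbf x ,$$ and let $u_1^{(n,1)},\dots,u_n^{(n,1)}\in\mathrm{span}\{q_1,\dots,q_n\}$ be corresponding eigenvectors, orthonormalized in $\mathcal H_{1/2}$. If $\ell\ge1$ and $u_1,\dots,u_\ell$ are all in $\mathcal D(M^\sigma)$, then there are eigenvectors $u_{j,n}$ of $A$ for the eigenvalue $\lambda_j$, normalized in $\mathcal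 H_{1/2}$, such that for $1\le j\le\ell$, as $n\to\infty$, $$\Lambda_j^{(n,1)}=\lambda_j+o(\mu_{n+1}^{2-2\sigma}),\qquad \|u_{j,n}-u_j^{(n,1)}\|_1=o(\mu_{n+1}^{1-\sigma}),\qquad \|u_{j,n}-u_j^{(n,1)}\|_{1/2}^2=o(\mu_{n+1}^{1-2\sigma}).$$ -/

import Mathlib

open Filter Asymptotics
open scoped InnerProductSpace ComplexOrder

/-- A positive definite selfadjoint (in general unbounded) operator in a complex Hilbert space:
a densely defined operator `op` with `op† = op` and `⟪op u, u⟫ ≥ α ‖u‖²` for some `α > 0`. -/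
structure PosDefOperator (H : Type*) [NormedAddCommGroup H] [InnerProductSpace ℂ H]
    [CompleteSpace H] where
  op : H →ₗ.[ℂ] H
  dense_domain : Dense (op.domain : Set H)
  selfAdjoint : IsSelfAdjoint op
  lowerBound : ∃ α : ℝ, 0 < α ∧
    ∀ u : op.domain, α * ‖(u : H)‖ ^ 2 ≤ RCLike.re ⟪op u, (u : H)⟫_ℂ

namespace PosDefOperator

variable {H : Type*} [NormedAddCommGroup H] [InnerProductSpace ℂ H] [CompleteSpace H]

theorem symm_apply (A : PosDefOperator H) (u v : A.op.domain) :
    ⟪A.op u, (v : H)⟫_ℂ = ⟪(u : H), A.op v⟫_ℂ := by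
  have h := LinearPMap.adjoint_isFormalAdjoint A.dense_domain
  have hs : LinearPMap.adjoint A.op = A.op := A.selfAdjoint
  rw [hs] at h
  exact h u v

theorem exists_norm_le (A : PosDefOperator H) :
    ∃ α : ℝ, 0 < α ∧ ∀ u : A.op.domain, α * ‖(u : H)‖ ≤ ‖A.op u‖ := by
  obtain ⟨α, hα, h⟩ := A.lowerBound
  refine ⟨α, hα, fun u => ?_⟩
  have h1 := h u
  have h2 : RCLike.re ⟪A.op u, (u : H)⟫_ℂ ≤ ‖A.op u‖ * ‖(u : H)‖ := re_inner_le_norm _ _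
  rcases (norm_nonneg (u : H)).eq_or_lt with h0 | h0
  · rw [← h0]; simp
  · nlinarith

theorem surjective (A : PosDefOperator H) : ∀ f : H, ∃ u : A.op.domain, A.op u = f := by
  obtain ⟨α, hα, hb⟩ := A.exists_norm_le
  have hs : LinearPMap.adjoint A.op = A.op := A.selfAdjoint
  set R : Submodule ℂ H := LinearMap.range A.op.toFun with hR
  have hclosed : IsClosed (R : Set H) := by
    rw [← isSeqClosed_iff_isClosed]
    intro x f hx hf
    choose u hu using hx
    have hu' : ∀ n, A.op (u n) = x n := hu
    have hc : CauchySeq (fun n => (u n : H)) := by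
      have hxc := hf.cauchySeq
      rw [Metric.cauchySeq_iff] at hxc ⊢
      intro ε hε
      obtain ⟨N, hN⟩ := hxc (α * ε) (by positivity)
      refine ⟨N, fun m hm n hn => ?_⟩
      have h1 := hN m hm n hn
      have h2 := hb (u m - u n)
      rw [dist_eq_norm] at h1 ⊢
      rw [LinearPMap.map_sub, hu', hu'] at h2
      have h3 : α * ‖(u m : H) - (u n : H)‖ < α * ε := lt_of_le_of_lt h2 h1
      exact lt_of_mul_lt_mul_left h3 hα.le
    obtain ⟨y, hy⟩ := cauchySeq_tendsto_of_complete hc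
    have hg : IsClosed (A.op.graph : Set (H × H)) := A.selfAdjoint.isClosed
    have hmem : (y, f) ∈ (A.op.graph : Set (H × H)) := by
      refine hg.mem_of_tendsto (hy.prodMk_nhds hf) (Eventually.of_forall fun n => ?_)
      have := A.op.mem_graph (u n)
      rw [hu'] at this
      exact this
    obtain ⟨z, -, hz⟩ := (LinearPMap.mem_graph_iff (f := A.op)).1 hmem
    exact ⟨z, hz⟩
  have hbot : Rᗮ = ⊥ := by
    rw [Submodule.eq_bot_iff]
    intro y hy
    have h0 : ∀ x : A.op.domain, ⟪(0 : H), (x : H)⟫_ℂ = ⟪y, A.op x⟫_ℂ := by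
      intro x
      rw [inner_zero_left]
      exact (Submodule.inner_left_of_mem_orthogonal (show A.op x ∈ R from LinearMap.mem_range_self _ x)
        hy).symm
    have hmem : y ∈ (LinearPMap.adjoint A.op).domain :=
      LinearPMap.mem_adjoint_domain_of_exists y ⟨0, h0⟩
    have hz := LinearPMap.adjoint_apply_eq A.dense_domain ⟨y, hmem⟩ h0
    have hmem' : y ∈ A.op.domain := by rw [← hs]; exact hmem
    have hz' : A.op ⟨y, hmem'⟩ = 0 := by
      have key : ∀ (B : H →ₗ.[ℂ] H), B = A.op → ∀ h : y ∈ B.domain, B ⟨y, h⟩ = 0 →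
          A.op ⟨y, hmem'⟩ = 0 := by
        rintro B rfl h h'
        exact h'
      exact key _ hs hmem hz
    have h1 := hb ⟨y, hmem'⟩
    rw [hz', norm_zero] at h1
    have h2 : ‖y‖ ≤ 0 := by
      by_contra hcon
      push Not at hcon
      have : 0 < α * ‖y‖ := by positivity
      exact absurd h1 (not_le.2 this)
    exact norm_le_zero_iff.1 h2
  have htop : R = ⊤ := by
    have : CompleteSpace R := hclosed.completeSpace_coe
    exact Submodule.orthogonal_eq_bot_iff.1 hbot
  intro f
  have : f ∈ R := by rw [htop]; trivial
  exact this

theorem exists_inverse (A : PosDefOperator H) :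
    ∃ T : H →L[ℂ] H, ∀ f : H, ∃ h : T f ∈ A.op.domain, A.op ⟨T f, h⟩ = f := by
  obtain ⟨α, hα, hb⟩ := A.exists_norm_le
  choose g hg using A.surjective
  have hinj : ∀ u v : A.op.domain, A.op u = A.op v → u = v := by
    intro u v h
    have h1 := hb (u - v)
    rw [LinearPMap.map_sub, h, sub_self, norm_zero] at h1
    have h2 : ‖((u - v : A.op.domain) : H)‖ ≤ 0 := by
      by_contra hcon
      push Not at hcon
      have : 0 < α * ‖((u - v : A.op.domain) : H)‖ := by positivity
      exact absurd h1 (not_le.2 this)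
    exact sub_eq_zero.1 (Subtype.ext (norm_le_zero_iff.1 h2))
  let L : H →ₗ[ℂ] H :=
    { toFun := fun f => (g f : H)
      map_add' := fun x y => by
        have : g (x + y) = g x + g y := hinj _ _ (by rw [LinearPMap.map_add, hg, hg, hg])
        rw [this]; rfl
      map_smul' := fun c x => by
        have : g (c • x) = c • g x := hinj _ _ (by rw [LinearPMap.map_smul, hg, hg])
        rw [this]; rfl }
  refine ⟨L.mkContinuous α⁻¹ fun f => ?_, fun f => ⟨(g f).2, hg f⟩⟩
  have h1 := hb (g f)
  rw [hg] at h1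
  change ‖(g f : H)‖ ≤ α⁻¹ * ‖f‖
  rw [inv_mul_eq_div, le_div_iff₀ hα, mul_comm]
  exact h1

/-- The bounded inverse `T = A⁻¹` on `H`. -/
noncomputable def inv (A : PosDefOperator H) : H →L[ℂ] H := A.exists_inverse.choose

theorem inv_mem (A : PosDefOperator H) (f : H) : A.inv f ∈ A.op.domain :=
  (A.exists_inverse.choose_spec f).1

theorem op_inv (A : PosDefOperator H) (f : H) : A.op ⟨A.inv f, A.inv_mem f⟩ = f :=
  (A.exists_inverse.choose_spec f).2

theorem inv_op (A : PosDefOperator H) (u : A.op.domain) : A.inv (A.op u) = u := by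
  obtain ⟨α, hα, hb⟩ := A.exists_norm_le
  have h1 := hb (⟨A.inv (A.op u), A.inv_mem _⟩ - u)
  rw [LinearPMap.map_sub, op_inv, sub_self, norm_zero] at h1
  have h2 : ‖A.inv (A.op u) - u‖ ≤ 0 := by
    by_contra hcon
    push Not at hcon
    have : 0 < α * ‖A.inv (A.op u) - u‖ := by positivity
    exact absurd h1 (not_le.2 this)
  exact sub_eq_zero.1 (norm_le_zero_iff.1 h2)

theorem inv_nonneg (A : PosDefOperator H) : 0 ≤ A.inv := by
  rw [ContinuousLinearMap.nonneg_iff_isPositive, ContinuousLinearMap.isPositive_def]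
  obtain ⟨α, hα, hb⟩ := A.lowerBound
  constructor
  · intro x y
    have h := A.symm_apply ⟨A.inv x, A.inv_mem x⟩ ⟨A.inv y, A.inv_mem y⟩
    rw [op_inv, op_inv] at h
    exact h.symm
  · intro x
    have h := hb ⟨A.inv x, A.inv_mem x⟩
    rw [op_inv] at h
    have h2 : RCLike.re ⟪x, A.inv x⟫_ℂ = RCLike.re ⟪A.inv x, x⟫_ℂ := inner_re_symm _ _
    rw [ContinuousLinearMap.reApplyInnerSelf_apply, ← h2]
    exact le_trans (by positivity) h

/-- The bounded operator `A^{-τ} = T^τ`, `τ ≥ 0`, given by the continuous functional calculus of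
the nonnegative bounded operator `T = A⁻¹`. -/
noncomputable def invPow (A : PosDefOperator H) (τ : ℝ) : H →L[ℂ] H := CFC.rpow A.inv τ

theorem invPow_injective (A : PosDefOperator H) {τ : ℝ} (hτ : 0 ≤ τ) :
    Function.Injective (A.invPow τ) := by
  have hinj1 : Function.Injective A.inv := by
    intro x y h
    have hx := A.op_inv x
    have hy := A.op_inv y
    rw [← hx, ← hy]
    congr 1
    exact Subtype.ext h
  have hinj : ∀ m : ℕ, Function.Injective (A.inv ^ m : H →L[ℂ] H) := by
    intro m
    induction m with
    | zero => intro x y h; simpa using h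
    | succ m ih =>
      intro x y h
      rw [pow_succ] at h
      exact hinj1 (ih h)
  rcases hτ.eq_or_lt with h0 | h0
  · rw [← h0]
    have : A.invPow 0 = 1 := CFC.rpow_zero A.inv A.inv_nonneg
    rw [this]
    intro x y h
    simpa using h
  · obtain ⟨m, hm⟩ := exists_nat_gt τ
    have h1 : (A.inv ^ m : H →L[ℂ] H) = A.invPow ((m : ℝ) - τ) * A.invPow τ := by
      obtain ⟨t, rfl⟩ : ∃ t : NNReal, (t : ℝ) = τ := ⟨τ.toNNReal, Real.coe_toNNReal _ hτ⟩
      obtain ⟨s, hs⟩ : ∃ s : NNReal, (s : ℝ) = (m : ℝ) - t :=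
        ⟨((m : ℝ) - t).toNNReal, Real.coe_toNNReal _ (by linarith)⟩
      have ht0 : 0 < t := NNReal.coe_pos.1 h0
      have hs0 : 0 < s := NNReal.coe_pos.1 (by rw [hs]; linarith)
      have e := CFC.nnrpow_add (a := A.inv) hs0 ht0
      rw [CFC.nnrpow_eq_rpow hs0, CFC.nnrpow_eq_rpow ht0, CFC.nnrpow_eq_rpow (by positivity),
        NNReal.coe_add, hs, sub_add_cancel, CFC.rpow_natCast A.inv m A.inv_nonneg] at e
      exact e
    have h2 := hinj m
    rw [h1] at h2
    intro x y h
    apply h2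
    change A.invPow _ (A.invPow τ x) = A.invPow _ (A.invPow τ y)
    rw [h]

/-- The fractional power `A^τ`, `τ ≥ 0`, as an unbounded operator: the inverse of the injective
bounded operator `A^{-τ}`. Its domain `𝒟(A^τ)` is the range of `A^{-τ}`. -/
noncomputable def fpow (A : PosDefOperator H) (τ : ℝ) : H →ₗ.[ℂ] H :=
  ((A.invPow τ : H →ₗ[ℂ] H).toPMap ⊤).inverse

/-- The domain `𝒟(A^τ)`, that is the space `ℋ_τ`, as a subspace of `H`. -/
noncomputable def dom (A : PosDefOperator H) (τ : ℝ) : Submodule ℂ H := (A.fpow τ).domain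

open Classical in
/-- `A^τ v` for `v ∈ 𝒟(A^τ)` (and `0` for other `v`). -/
noncomputable def fpowApply (A : PosDefOperator H) (τ : ℝ) (v : H) : H :=
  if h : v ∈ (A.fpow τ).domain then A.fpow τ ⟨v, h⟩ else 0

/-- The inner product `⟨u, v⟩_τ = ⟨A^τ u, A^τ v⟩` of `ℋ_τ = 𝒟(A^τ)`; as is usual in Mathlib, it is
conjugate linear in the first variable. -/
noncomputable def innerPow (A : PosDefOperator H) (τ : ℝ) (u v : H) : ℂ :=
  ⟪A.fpowApply τ u, A.fpowApply τ v⟫_ℂ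

/-- The norm `‖v‖_τ = ‖A^τ v‖` of `ℋ_τ = 𝒟(A^τ)`. -/
noncomputable def normPow (A : PosDefOperator H) (τ : ℝ) (v : H) : ℝ := ‖A.fpowApply τ v‖

theorem mem_dom_iff (A : PosDefOperator H) {τ : ℝ} (v : H) :
    v ∈ A.dom τ ↔ ∃ f, A.invPow τ f = v := by
  rw [dom, fpow, LinearPMap.inverse_domain]
  constructor
  · rintro ⟨f, hf⟩
    exact ⟨f, hf⟩
  · rintro ⟨f, hf⟩
    exact ⟨⟨f, trivial⟩, hf⟩

theorem fpowApply_invPow (A : PosDefOperator H) {τ : ℝ} (hτ : 0 ≤ τ) (f : H) :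
    A.fpowApply τ (A.invPow τ f) = f := by
  have hker : LinearMap.ker ((A.invPow τ : H →ₗ[ℂ] H).toPMap ⊤).toFun = ⊥ := by
    rw [LinearMap.ker_eq_bot]
    intro x y h
    exact Subtype.ext (A.invPow_injective hτ h)
  have hm : A.invPow τ f ∈ (A.fpow τ).domain := (A.mem_dom_iff _).2 ⟨f, rfl⟩
  rw [fpowApply, dif_pos hm]
  exact LinearPMap.inverse_apply_eq hker (x := ⟨f, trivial⟩) rfl

theorem invPow_fpowApply (A : PosDefOperator H) {τ : ℝ} (hτ : 0 ≤ τ) {v : H} (hv : v ∈ A.dom τ) :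
    A.invPow τ (A.fpowApply τ v) = v := by
  obtain ⟨f, rfl⟩ := (A.mem_dom_iff v).1 hv
  rw [A.fpowApply_invPow hτ]

theorem invPow_one (A : PosDefOperator H) : A.invPow 1 = A.inv := CFC.rpow_one A.inv A.inv_nonneg

/-- The first power is the operator itself. -/
theorem fpow_one (A : PosDefOperator H) : A.fpow 1 = A.op := by
  have hd : (A.fpow 1).domain = A.op.domain := by
    ext v
    change v ∈ A.dom 1 ↔ _
    rw [A.mem_dom_iff, A.invPow_one]
    constructor
    · rintro ⟨f, rfl⟩; exact A.inv_mem f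
    · intro h; exact ⟨A.op ⟨v, h⟩, A.inv_op ⟨v, h⟩⟩
  refine LinearPMap.ext hd ?_
  intro x hx hx'
  have h1 := A.fpowApply_invPow zero_le_one (A.op ⟨x, hx'⟩)
  rw [A.invPow_one, A.inv_op, fpowApply, dif_pos hx] at h1
  exact h1

instance hasOrthogonalProjection_span {n : ℕ} (w : Fin n → H) :
    (Submodule.span ℂ (Set.range w)).HasOrthogonalProjection :=
  have : FiniteDimensional ℂ (Submodule.span ℂ (Set.range w)) :=
    FiniteDimensional.span_of_finite ℂ (Set.finite_range w)
  inferInstance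

/-- The orthogonal projection `P_{n,τ} : ℋ_τ → span {w_0, …, w_{n-1}}` in the Hilbert space `ℋ_τ`,
for `w_k ∈ ℋ_τ`. Since `A^τ : ℋ_τ → H` is unitary, this is the orthogonal projection of `H` onto
the span of the `A^τ w_k`, transported by `A^τ`. -/
noncomputable def proj (A : PosDefOperator H) (τ : ℝ) {n : ℕ} (w : Fin n → H) (v : H) : H :=
  A.invPow τ ((Submodule.span ℂ (Set.range fun k => A.fpowApply τ (w k))).starProjection
    (A.fpowApply τ v))

/-- The projection lies in the span of the trial vectors. -/
theorem proj_mem_span (A : PosDefOperator H) {τ : ℝ} (hτ : 0 ≤ τ) {n : ℕ} (w : Fin n → H)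
    (hw : ∀ k, w k ∈ A.dom τ) (v : H) : A.proj τ w v ∈ Submodule.span ℂ (Set.range w) := by
  have h := Submodule.mem_map_of_mem (f := (A.invPow τ : H →ₗ[ℂ] H))
    (Submodule.starProjection_apply_mem
      (Submodule.span ℂ (Set.range fun k => A.fpowApply τ (w k))) (A.fpowApply τ v))
  rw [Submodule.map_span, ← Set.range_comp] at h
  have e : ((A.invPow τ : H →ₗ[ℂ] H) ∘ fun k => A.fpowApply τ (w k)) = w := by
    funext k
    exact A.invPow_fpowApply hτ (hw k)
  rw [e] at h
  exact h

/-- The error of the projection is `ℋ_τ`-orthogonal to the trial vectors. -/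
theorem innerPow_sub_proj (A : PosDefOperator H) {τ : ℝ} (hτ : 0 ≤ τ) {n : ℕ} (w : Fin n → H)
    {v : H} (hv : v ∈ A.dom τ) (k : Fin n) : A.innerPow τ (w k) (v - A.proj τ w v) = 0 := by
  have e : v - A.proj τ w v = A.invPow τ (A.fpowApply τ v -
      (Submodule.span ℂ (Set.range fun k => A.fpowApply τ (w k))).starProjection
        (A.fpowApply τ v)) := by
    rw [map_sub, A.invPow_fpowApply hτ hv, proj]
  rw [innerPow, e, A.fpowApply_invPow hτ]
  have hk : A.fpowApply τ (w k) ∈ Submodule.span ℂ (Set.range fun k => A.fpowApply τ (w k)) :=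
    Submodule.subset_span (Set.mem_range_self k)
  exact Submodule.inner_right_of_mem_orthogonal hk (Submodule.sub_starProjection_mem_orthogonal _)

/-- `μ_0 ≤ μ_1 ≤ …` are the eigenvalues of `A`, all of them and counted according to multiplicity,
and `q_0, q_1, …` are corresponding orthonormal eigenvectors. -/
structure IsEigensystem (A : PosDefOperator H) (μ : ℕ → ℝ) (q : ℕ → H) : Prop where
  mono : Monotone μ
  orthonormal : Orthonormal ℂ q
  eigen : ∀ k, ∃ h : q k ∈ A.op.domain, A.op ⟨q k, h⟩ = (μ k : ℂ) • q k
  exhaust : ∀ (ν : ℝ) (x : A.op.domain), A.op x = (ν : ℂ) • (x : H) →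
    (x : H) ∈ Submodule.span ℂ (q '' {k | μ k = ν})

/-- Harmonic Ritz eigenpairs (the Rayleigh-Ritz method for `A` in `ℋ_1 = 𝒟(A)`) for the trial
vectors `w_0, …, w_{n-1}`: the `Λ_0 ≤ … ≤ Λ_{n-1}` are the eigenvalues of the generalized matrix
eigenvalue problem `[⟨w_i, w_k⟩_1] c = Λ [⟨T w_i, w_k⟩_1] c`, `T = A⁻¹`, and the vectors
`x_i = ∑_k c_{i,k} w_k` are corresponding eigenvectors, orthonormalized in `ℋ_{1/2}`. -/
def IsHarmonicRitz (A : PosDefOperator H) {n : ℕ} (w : Fin n → H) (Λ : Fin n → ℝ)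
    (x : Fin n → H) : Prop :=
  Monotone Λ ∧
  (∃ c : Fin n → Fin n → ℂ, ∀ i,
    (Matrix.of fun k l => A.innerPow 1 (w k) (w l)).mulVec (c i) =
      (Λ i : ℂ) • (Matrix.of fun k l => A.innerPow 1 (A.inv (w k)) (w l)).mulVec (c i) ∧
    x i = ∑ k, c i k • w k) ∧
  ∀ i k, A.innerPow (1 / 2) (x i) (x k) = if i = k then 1 else 0

end PosDefOperator

/-!
The substitution `f = A v` identifies `𝒟(A)` with `H` and turns all the norms of the theorem into
norms of bounded operators: with `S = A^{-1/2}`, `‖v‖_1 = ‖f‖` and `‖v‖_{1/2} = ‖S f‖`. The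
projection in `ℋ_1` becomes the orthogonal projection `P_n` of `H` onto the span `V_n` of the
`A q_k`, and the harmonic Ritz pairs become the Rayleigh-Ritz pairs in `V_n` for the quotient
`‖f‖² / ‖S f‖²` (`PosDefOperator.IsHarmonicRitz.isRitzSystem`).

The link between `A` and `M` is the Heinz inequality
(`PosDefOperator.exists_invPow_eq_of_le`): as `𝒟(M^{3/2}) ⊆ 𝒟(A^{3/2})` boundedly, also
`𝒟(M) ⊆ 𝒟(A)` boundedly. Both operators have an orthonormal basis of eigenvectors, because
`A^{-3/2}` inherits compactness from `M^{-3/2}`, so the inequality follows from the three lines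
theorem for finite matrices (`sum_norm_sq_rpow_weight_le`). Truncation of the expansion in the
`q_k` then gives `‖(1 - P_n) f‖ ≤ C μ_n^{-τ} ‖tail of h‖` for `A⁻¹ f = M^{-1-τ} h`
(`PosDefOperator.norm_sub_starProjection_trialSpan_le`). For `τ = σ - 1` this is the rate
`o(μ_n^{1-σ})` in `ℋ_1`. For `τ = 1/2`, and since `𝒟(A^{3/2}) ⊆ 𝒟(M^{3/2})` boundedly, it says that
`‖(1 - P_n) S‖ ≤ C μ_n^{-1/2}`, and by duality `‖S (1 - P_n) f‖ ≤ C μ_n^{-1/2} ‖(1 - P_n) f‖`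
(`norm_apply_sub_starProjection_le`). Together these prove the estimate of the projection error.

For the Ritz values, the min-max principle gives `λ_j ≤ Λ_j` and, tested with the projections of
the first eigenvectors, `Λ_j - λ_j = O(∑_{i ≤ j} ‖(1 - P_n) u_i‖²)`
(`IsRitzSystem.one_le_mul`, `IsRitzSystem.mul_le_one`). A Ritz vector `x` is compared with its
projection to the eigenspace of `λ_j`: the remaining part `z` satisfies
`(A⁻¹ - Λ_j⁻¹) x = (1 - P_n) (A⁻¹ - λ_j⁻¹) z`, so duality and the gap in the spectrum yield
`‖S z‖ ≤ C μ_n^{-1/2} ‖z‖`. Inserted into `‖z‖² = Λ_j - λ_j + λ_j ‖S z‖²`, this bounds `‖z‖²` by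
a multiple of `Λ_j - λ_j` for large `n` (`exists_eigenvector_near`). Eigenvectors for `λ_j` other than
`u_1, …, u_ℓ` need not be smooth, and nothing is asked of them.
-/

/-! ### Functional calculus and eigenvectors -/

section FunctionalCalculus

variable {H : Type*} [NormedAddCommGroup H] [InnerProductSpace ℂ H] [CompleteSpace H]

/-- The continuous functional calculus acts on an eigenvector by evaluation at the eigenvalue. -/
theorem cfc_apply_eigenvector {a : H →L[ℂ] H} (ha : IsSelfAdjoint a) {r : ℝ} {v : H}
    (hv : a v = (r : ℂ) • v) (f : ℝ → ℝ) (hf : ContinuousOn f (spectrum ℝ a)) :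
    cfc f a v = (f r : ℂ) • v := by
  rcases eq_or_ne v 0 with rfl | hv0
  · simp
  have hr : r ∈ spectrum ℝ a := by
    intro hu
    obtain ⟨b, hb⟩ := hu
    have h1 : (algebraMap ℝ (H →L[ℂ] H) r - a) v = 0 := by
      rw [Algebra.algebraMap_eq_smul_one]
      simp [hv]
    rw [← hb] at h1
    have h2 : ((b⁻¹ : (H →L[ℂ] H)ˣ) * b : H →L[ℂ] H) v = 0 := by
      rw [mul_apply_eq_comp, h1, map_zero]
    rw [Units.inv_mul] at h2
    exact hv0 h2
  rw [cfc_apply f a ha hf]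
  have key : ∀ g : C(spectrum ℝ a, ℝ), cfcHom (R := ℝ) ha g v = (g ⟨r, hr⟩ : ℂ) • v := by
    intro g
    induction g using ContinuousMap.induction_on_of_compact with
    | const c =>
      have : ContinuousMap.const (spectrum ℝ a) c = algebraMap ℝ C(spectrum ℝ a, ℝ) c := rfl
      rw [this, AlgHomClass.commutes, Algebra.algebraMap_eq_smul_one]
      simp
    | id => rw [cfcHom_id ha]; simpa using hv
    | star_id => rw [map_star, cfcHom_id ha, ha.star_eq]; simpa using hv
    | add f g hf hg => rw [map_add]; simp [hf, hg, add_smul]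
    | mul f g hf hg =>
      rw [map_mul, ContinuousMap.mul_apply, mul_comm (f _), Complex.ofReal_mul, mul_smul, ← hf,
        mul_apply_eq_comp, hg, ContinuousLinearMap.map_smul]
    | frequently f h =>
      refine h.mem_of_closed (isClosed_eq ?_ (by fun_prop))
      have := cfcHom_continuous (R := ℝ) ha
      fun_prop
  exact key _

/-- The powers of a nonnegative operator act on an eigenvector by the powers of the eigenvalue. -/
theorem rpow_apply_eigenvector {a : H →L[ℂ] H} (ha : 0 ≤ a) {r : ℝ} (hr : 0 ≤ r) {v : H}
    (hv : a v = (r : ℂ) • v) {τ : ℝ} (hτ : 0 ≤ τ) :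
    CFC.rpow a τ v = ((r ^ τ : ℝ) : ℂ) • v := by
  have h1 : CFC.rpow a τ = cfc (fun x : NNReal => x ^ τ) a := rfl
  rw [h1, cfc_nnreal_eq_real _ a ha, cfc_apply_eigenvector ha.isSelfAdjoint hv]
  · simp [Real.coe_toNNReal _ hr]
  · refine Continuous.continuousOn ?_
    have := NNReal.continuous_rpow_const hτ
    fun_prop

end FunctionalCalculus

namespace PosDefOperator

variable {H : Type*} [NormedAddCommGroup H] [InnerProductSpace ℂ H] [CompleteSpace H]

theorem invPow_nonneg (A : PosDefOperator H) (τ : ℝ) : 0 ≤ A.invPow τ := CFC.rpow_nonneg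

theorem inner_invPow (A : PosDefOperator H) (τ : ℝ) (x y : H) :
    ⟪A.invPow τ x, y⟫_ℂ = ⟪x, A.invPow τ y⟫_ℂ := by
  have h := A.invPow_nonneg τ
  rw [ContinuousLinearMap.nonneg_iff_isPositive] at h
  exact h.isSymmetric x y

theorem invPow_zero (A : PosDefOperator H) : A.invPow 0 = 1 := CFC.rpow_zero A.inv A.inv_nonneg

theorem invPow_add (A : PosDefOperator H) {s t : ℝ} (hs : 0 ≤ s) (ht : 0 ≤ t) (f : H) :
    A.invPow (s + t) f = A.invPow s (A.invPow t f) := by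
  rcases hs.eq_or_lt with rfl | hs
  · rw [zero_add, invPow_zero, one_apply_eq_self]
  rcases ht.eq_or_lt with rfl | ht
  · rw [add_zero, invPow_zero, one_apply_eq_self]
  have hs' : 0 < s.toNNReal := by simpa using hs
  have ht' : 0 < t.toNNReal := by simpa using ht
  have e := CFC.nnrpow_add (a := A.inv) hs' ht'
  rw [CFC.nnrpow_eq_rpow hs', CFC.nnrpow_eq_rpow ht', CFC.nnrpow_eq_rpow (add_pos hs' ht'),
    NNReal.coe_add, Real.coe_toNNReal _ hs.le, Real.coe_toNNReal _ ht.le] at e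
  exact congrArg (fun B : H →L[ℂ] H => B f) e

theorem inv_eq_invPow_half (A : PosDefOperator H) (f : H) :
    A.inv f = A.invPow (1 / 2) (A.invPow (1 / 2) f) := by
  rw [← A.invPow_add (by norm_num) (by norm_num), ← A.invPow_one]
  norm_num

theorem inv_injective (A : PosDefOperator H) : Function.Injective A.inv :=
  A.invPow_one ▸ A.invPow_injective zero_le_one

/-- An eigenvector of `A⁻¹` is an eigenvector of `A`. -/
theorem op_eq_of_inv_eq (A : PosDefOperator H) {r : ℝ} {v : H} (hr : r ≠ 0)
    (h : A.inv v = ((r⁻¹ : ℝ) : ℂ) • v) :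
    ∃ hv : v ∈ A.op.domain, A.op ⟨v, hv⟩ = (r : ℂ) • v := by
  have e : v = A.inv ((r : ℂ) • v) := by
    rw [map_smul, h, smul_smul, ← Complex.ofReal_mul, mul_inv_cancel₀ hr]
    simp
  have hv : v ∈ A.op.domain := e ▸ A.inv_mem _
  refine ⟨hv, ?_⟩
  rw [← A.op_inv ((r : ℂ) • v)]
  congr 1
  exact Subtype.ext e

namespace IsEigensystem

variable {A : PosDefOperator H} {μ : ℕ → ℝ} {q : ℕ → H}

theorem pos (hq : A.IsEigensystem μ q) (k : ℕ) : 0 < μ k := by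
  obtain ⟨α, hα, hb⟩ := A.lowerBound
  obtain ⟨h, e⟩ := hq.eigen k
  have h1 := hb ⟨q k, h⟩
  rw [e, inner_smul_left] at h1
  simp [hq.orthonormal.1 k] at h1
  linarith

theorem inv_apply (hq : A.IsEigensystem μ q) (k : ℕ) :
    A.inv (q k) = (((μ k)⁻¹ : ℝ) : ℂ) • q k := by
  obtain ⟨h, e⟩ := hq.eigen k
  have h1 := A.inv_op ⟨q k, h⟩
  rw [e, map_smul] at h1
  have h2 : (μ k : ℂ) ≠ 0 := by exact_mod_cast (hq.pos k).ne'
  simp only at h1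
  nth_rewrite 2 [← h1]
  rw [smul_smul, Complex.ofReal_inv, inv_mul_cancel₀ h2, one_smul]

theorem invPow_apply (hq : A.IsEigensystem μ q) {τ : ℝ} (hτ : 0 ≤ τ) (k : ℕ) :
    A.invPow τ (q k) = ((μ k ^ (-τ) : ℝ) : ℂ) • q k := by
  have h0 := (hq.pos k).le
  rw [invPow, rpow_apply_eigenvector A.inv_nonneg (_root_.inv_nonneg.2 h0) (hq.inv_apply k) hτ,
    Real.inv_rpow h0, Real.rpow_neg h0]

/-- If some negative power of `A` is compact, then the eigenvectors of `A` are total. -/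
theorem span_eq_top (hq : A.IsEigensystem μ q) {τ : ℝ} (hτ : 0 < τ)
    (hc : IsCompactOperator (A.invPow τ)) :
    ⊤ ≤ (Submodule.span ℂ (Set.range q)).topologicalClosure := by
  have hpos := A.invPow_nonneg τ
  have hpos' := hpos
  rw [ContinuousLinearMap.nonneg_iff_isPositive] at hpos'
  have hbot := ContinuousLinearMap.orthogonalComplement_iSup_eigenspaces_eq_bot
    (T := A.invPow τ) hc hpos'.isSymmetric
  have hle : (⨆ c, Module.End.eigenspace ((A.invPow τ : H →ₗ[ℂ] H)) c) ≤
      Submodule.span ℂ (Set.range q) := by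
    refine iSup_le fun c v hv => ?_
    rcases eq_or_ne v 0 with rfl | hv0
    · exact Submodule.zero_mem _
    have hcv : A.invPow τ v = c • v := Module.End.mem_eigenspace_iff.1 hv
    obtain ⟨r, hr0, hr⟩ : ∃ r : ℝ, 0 ≤ r ∧ (r : ℂ) = c := by
      have h1 := hpos'.inner_nonneg_right v
      rw [hcv, inner_smul_right, inner_self_eq_norm_sq_to_K] at h1
      have h2 : (0 : ℝ) < ‖v‖ ^ 2 := by positivity
      rw [Complex.le_def] at h1
      norm_cast at h1
      change 0 ≤ (c * ((‖v‖ ^ 2 : ℝ) : ℂ)).re ∧ 0 = (c * ((‖v‖ ^ 2 : ℝ) : ℂ)).im at h1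
      rw [Complex.re_mul_ofReal, Complex.im_mul_ofReal] at h1
      refine ⟨c.re, nonneg_of_mul_nonneg_left h1.1 h2, Complex.ext (by simp) ?_⟩
      have := mul_eq_zero.1 h1.2.symm
      rw [Complex.ofReal_im]
      exact (this.resolve_right h2.ne').symm
    subst hr
    have hr1 : 0 < r := by
      refine lt_of_le_of_ne hr0 fun h => hv0 ?_
      refine A.invPow_injective hτ.le ?_
      rw [hcv, ← h]
      simp
    have h3 := rpow_apply_eigenvector hpos hr0 hcv (_root_.inv_nonneg.2 hτ.le)
    have h4 : CFC.rpow (A.invPow τ) τ⁻¹ = A.inv := by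
      have := CFC.rpow_rpow_of_exponent_nonneg A.inv τ τ⁻¹ hτ.le (_root_.inv_nonneg.2 hτ.le) A.inv_nonneg
      rw [mul_inv_cancel₀ hτ.ne', CFC.rpow_one _ A.inv_nonneg] at this
      exact this
    rw [h4] at h3
    have h5 : 0 < r ^ τ⁻¹ := Real.rpow_pos_of_pos hr1 _
    obtain ⟨hm, he⟩ := A.op_eq_of_inv_eq (r := (r ^ τ⁻¹)⁻¹) (inv_ne_zero h5.ne')
      (by rw [inv_inv]; exact h3)
    exact Submodule.span_mono (Set.image_subset_range _ _) (hq.exhaust _ _ he)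
  rw [top_le_iff, Submodule.topologicalClosure_eq_top_iff, eq_bot_iff, ← hbot]
  exact Submodule.orthogonal_le hle

/-- The eigenvectors of an operator with a compact negative power, as a Hilbert basis. -/
noncomputable def hilbertBasis (hq : A.IsEigensystem μ q) {τ : ℝ} (hτ : 0 < τ)
    (hc : IsCompactOperator (A.invPow τ)) : HilbertBasis ℕ ℂ H :=
  HilbertBasis.mk hq.orthonormal (hq.span_eq_top hτ hc)

theorem hilbertBasis_apply (hq : A.IsEigensystem μ q) {τ : ℝ} (hτ : 0 < τ)
    (hc : IsCompactOperator (A.invPow τ)) (k : ℕ) : hq.hilbertBasis hτ hc k = q k := by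
  rw [hilbertBasis, HilbertBasis.coe_mk]

theorem tendsto_atTop (hq : A.IsEigensystem μ q) (hc : IsCompactOperator A.inv) :
    Tendsto μ atTop atTop := by
  refine tendsto_atTop_atTop_of_monotone' hq.mono fun ⟨R, hR⟩ => ?_
  have hR' : ∀ k, μ k ≤ R := fun k => hR (Set.mem_range_self k)
  have hR0 : 0 < R := (hq.pos 0).trans_le (hR' 0)
  obtain ⟨K, hK, hsub⟩ := hc.image_closedBall_subset_compact (𝕜₁ := ℂ) (f := (A.inv : H →ₗ[ℂ] H)) 1
  obtain ⟨a, -, φ, hφ, hlim⟩ := hK.tendsto_subseq (x := fun k => A.inv (q k)) fun k =>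
    hsub ⟨q k, by simp [hq.orthonormal.1 k], rfl⟩
  have hcau := hlim.cauchySeq
  rw [Metric.cauchySeq_iff] at hcau
  obtain ⟨N, hN⟩ := hcau R⁻¹ (inv_pos.2 hR0)
  have h1 := hN N le_rfl (N + 1) (Nat.le_succ N)
  simp only [Function.comp, dist_eq_norm, hq.inv_apply] at h1
  -- the component along the first of the two eigenvectors is already too large
  have h2 : R⁻¹ ≤ ‖⟪q (φ N), (((μ (φ N))⁻¹ : ℝ) : ℂ) • q (φ N) -
      (((μ (φ (N + 1)))⁻¹ : ℝ) : ℂ) • q (φ (N + 1))⟫_ℂ‖ := by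
    rw [inner_sub_right, inner_smul_right, inner_smul_right, inner_self_eq_norm_sq_to_K,
      hq.orthonormal.1, hq.orthonormal.2 (hφ (Nat.lt_succ_self N)).ne]
    simp only [RCLike.ofReal_one, one_pow, mul_one, mul_zero, sub_zero, Complex.norm_real]
    rw [Real.norm_of_nonneg (_root_.inv_nonneg.2 (hq.pos _).le)]
    exact inv_anti₀ (hq.pos _) (hR' _)
  have h3 := norm_inner_le_norm (𝕜 := ℂ) (q (φ N)) ((((μ (φ N))⁻¹ : ℝ) : ℂ) • q (φ N) -
      (((μ (φ (N + 1)))⁻¹ : ℝ) : ℂ) • q (φ (N + 1)))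
  rw [hq.orthonormal.1, one_mul] at h3
  linarith

end IsEigensystem

end PosDefOperator

/-! ### Interpolation -/

section Interpolation

/-- Interpolation between the weights `1` and `a`, `d` for a finite matrix `b`: a bound of the
matrices `b` and `(a i * b i k * d k)` bounds all `(a i ^ θ * b i k * d k ^ θ)` with
`0 ≤ θ ≤ 1`, by the three lines theorem. -/
theorem sum_norm_sq_rpow_weight_le {ι κ : Type*} [Fintype ι] [Fintype κ] (b : ι → κ → ℂ)
    {a : ι → ℝ} {d : κ → ℝ} (ha : ∀ i, 0 < a i) (hd : ∀ k, 0 < d k) {C : ℝ} (hC : 0 ≤ C)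
    (h0 : ∀ c : κ → ℂ, ∑ i, ‖∑ k, b i k * c k‖ ^ 2 ≤ C ^ 2 * ∑ k, ‖c k‖ ^ 2)
    (h1 : ∀ c : κ → ℂ, ∑ i, ‖(a i : ℂ) * ∑ k, b i k * (d k * c k)‖ ^ 2 ≤ C ^ 2 * ∑ k, ‖c k‖ ^ 2)
    {θ : ℝ} (hθ : θ ∈ Set.Icc (0 : ℝ) 1) (c : κ → ℂ) :
    ∑ i, ‖((a i ^ θ : ℝ) : ℂ) * ∑ k, b i k * (((d k ^ θ : ℝ) : ℂ) * c k)‖ ^ 2 ≤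
      C ^ 2 * ∑ k, ‖c k‖ ^ 2 := by
  set D : ℝ := √(∑ k, ‖c k‖ ^ 2) with hD
  have hD2 : D ^ 2 = ∑ k, ‖c k‖ ^ 2 := Real.sq_sqrt (by positivity)
  let F : ℂ → EuclideanSpace ℂ ι := fun z =>
    WithLp.toLp 2 fun i => (a i : ℂ) ^ z * ∑ k, b i k * ((d k : ℂ) ^ z * c k)
  have hF : ∀ z i, F z i = (a i : ℂ) ^ z * ∑ k, b i k * ((d k : ℂ) ^ z * c k) := fun z i => rfl
  have hsplit : ∀ {x : ℝ}, 0 < x → ∀ z : ℂ,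
      (x : ℂ) ^ z = ((x ^ z.re : ℝ) : ℂ) * (x : ℂ) ^ ((z.im : ℂ) * Complex.I) := by
    intro x hx z
    rw [Complex.ofReal_cpow hx.le, ← Complex.cpow_add _ _ (by exact_mod_cast hx.ne'),
      Complex.re_add_im]
  have hunit : ∀ {x : ℝ}, 0 < x → ∀ t : ℝ, ‖(x : ℂ) ^ ((t : ℂ) * Complex.I)‖ = 1 := by
    intro x hx t
    rw [Complex.norm_cpow_eq_rpow_re_of_pos hx]
    simp
  -- on a vertical line the imaginary part of the exponent only rotates the coefficients
  have hline : ∀ z : ℂ, ‖F z‖ ^ 2 = ∑ i, ‖((a i ^ z.re : ℝ) : ℂ) * ∑ k, b i k *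
      (((d k ^ z.re : ℝ) : ℂ) * ((d k : ℂ) ^ ((z.im : ℂ) * Complex.I) * c k))‖ ^ 2 := by
    intro z
    rw [EuclideanSpace.norm_sq_eq]
    refine Finset.sum_congr rfl fun i _ => ?_
    rw [hF, hsplit (ha i), norm_mul, norm_mul, norm_mul, hunit (ha i), mul_one]
    simp only [fun k => hsplit (hd k) z, mul_assoc]
  have hrot : ∀ t : ℝ, ∑ k, ‖(d k : ℂ) ^ ((t : ℂ) * Complex.I) * c k‖ ^ 2 = D ^ 2 := by
    intro t
    rw [hD2]
    refine Finset.sum_congr rfl fun k _ => ?_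
    rw [norm_mul, hunit (hd k), one_mul]
  have hCD : 0 ≤ C * D := by positivity
  have key := Complex.HadamardThreeLines.norm_le_interp_of_mem_verticalClosedStrip₀₁' F
    (z := (θ : ℂ)) (a := C * D) (b := C * D) (by
      simpa [Complex.HadamardThreeLines.verticalClosedStrip] using hθ) ?_ ?_ ?_ ?_
  · rw [← Real.rpow_add' hCD (by simp), sub_add_cancel, Real.rpow_one] at key
    have h2 := hline θ
    have h3 := pow_le_pow_left₀ (norm_nonneg _) key 2
    rw [h2, mul_pow, hD2] at h3
    simpa using h3
  · refine Differentiable.diffContOnCl ?_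
    rw [differentiable_euclidean]
    intro i
    simp only [hF]
    have : ∀ {x : ℝ}, 0 < x → Differentiable ℂ fun z : ℂ => (x : ℂ) ^ z := fun hx =>
      differentiable_id.const_cpow (Or.inl (by exact_mod_cast hx.ne'))
    exact (this (ha i)).mul (Differentiable.fun_sum fun k _ =>
      (((this (hd k)).mul_const _).const_mul _))
  · let Φ : ℝ → ℝ := fun t => ∑ i, (a i ^ t * ∑ k, ‖b i k‖ * (d k ^ t * ‖c k‖)) ^ 2
    have hΦ : Continuous Φ := by
      have : ∀ {x : ℝ}, 0 < x → Continuous fun t : ℝ => x ^ t := fun hx =>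
        Real.continuous_const_rpow hx.ne'
      refine continuous_finsetSum _ fun i _ => ((this (ha i)).mul
        (continuous_finsetSum _ fun k _ => ?_)).pow 2
      exact continuous_const.mul ((this (hd k)).mul continuous_const)
    obtain ⟨R, hR⟩ := (isCompact_Icc (a := (0 : ℝ)) (b := 1)).bddAbove_image hΦ.continuousOn
    refine ⟨√R, ?_⟩
    rintro _ ⟨z, hz, rfl⟩
    refine Real.le_sqrt_of_sq_le (le_trans ?_ (hR ⟨z.re, hz, rfl⟩))
    simp only [Function.comp]
    rw [EuclideanSpace.norm_sq_eq]
    refine Finset.sum_le_sum fun i _ => pow_le_pow_left₀ (norm_nonneg _) ?_ 2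
    rw [hF, norm_mul, Complex.norm_cpow_eq_rpow_re_of_pos (ha i)]
    refine mul_le_mul_of_nonneg_left ((norm_sum_le _ _).trans_eq ?_)
      (Real.rpow_nonneg (ha i).le _)
    refine Finset.sum_congr rfl fun k _ => ?_
    rw [norm_mul, norm_mul, Complex.norm_cpow_eq_rpow_re_of_pos (hd k)]
  · intro z hz
    have hz' : z.re = 0 := hz
    refine le_of_sq_le_sq ?_ hCD
    rw [hline, hz', mul_pow, ← hrot z.im]
    simpa using h0 fun k => (d k : ℂ) ^ ((z.im : ℂ) * Complex.I) * c k
  · intro z hz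
    have hz' : z.re = 1 := hz
    refine le_of_sq_le_sq ?_ hCD
    rw [hline, hz', mul_pow, ← hrot z.im]
    simpa using h1 fun k => (d k : ℂ) ^ ((z.im : ℂ) * Complex.I) * c k

end Interpolation

section HilbertBasis

variable {H : Type*} [NormedAddCommGroup H] [InnerProductSpace ℂ H]

theorem HilbertBasis.hasSum_norm_inner_sq {ι : Type*} (b : HilbertBasis ι ℂ H) (x : H) :
    HasSum (fun i => ‖⟪b i, x⟫_ℂ‖ ^ 2) (‖x‖ ^ 2) := by
  have h := b.hasSum_inner_mul_inner x x
  rw [inner_self_eq_norm_sq_to_K] at h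
  have e : ∀ i, ⟪x, b i⟫_ℂ * ⟪b i, x⟫_ℂ = ((‖⟪b i, x⟫_ℂ‖ ^ 2 : ℝ) : ℂ) := by
    intro i
    rw [← inner_conj_symm x (b i), RCLike.conj_mul]
    norm_cast
  simp only [e] at h
  have h' : HasSum (fun i => ((‖⟪b i, x⟫_ℂ‖ ^ 2 : ℝ) : ℂ)) ((‖x‖ ^ 2 : ℝ) : ℂ) := by
    rw [Complex.ofReal_pow]
    exact h
  exact Complex.hasSum_ofReal.1 h'

theorem HilbertBasis.ext_inner {ι : Type*} (b : HilbertBasis ι ℂ H) {x y : H}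
    (h : ∀ i, ⟪b i, x⟫_ℂ = ⟪b i, y⟫_ℂ) : x = y := by
  refine b.repr.injective (lp.ext ?_)
  funext i
  rw [b.repr_apply_apply, b.repr_apply_apply, h]

/-- Riesz-Fischer: square summable coefficients are those of a vector. -/
theorem HilbertBasis.exists_inner_eq (b : HilbertBasis ℕ ℂ H) {g : ℕ → ℂ} {C : ℝ} (hC : 0 ≤ C)
    (hg : ∀ m : ℕ, ∑ i ∈ Finset.range m, ‖g i‖ ^ 2 ≤ C ^ 2) :
    ∃ f : H, (∀ i, ⟪b i, f⟫_ℂ = g i) ∧ ‖f‖ ≤ C := by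
  have hs : Summable fun i => ‖g i‖ ^ 2 := summable_of_sum_range_le (fun _ => by positivity) hg
  have hm : Memℓp g 2 := memℓp_gen (by simpa using hs)
  have hf : ∀ i, ⟪b i, b.repr.symm ⟨g, hm⟩⟫_ℂ = g i := by
    intro i
    rw [← b.repr_apply_apply, LinearIsometryEquiv.apply_symm_apply]
  refine ⟨b.repr.symm ⟨g, hm⟩, hf, ?_⟩
  have h := (b.hasSum_norm_inner_sq (b.repr.symm ⟨g, hm⟩)).tendsto_sum_nat
  simp only [hf] at h
  exact le_of_sq_le_sq (le_of_tendsto' h hg) hC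

theorem HilbertBasis.tendsto_sum_range (b : HilbertBasis ℕ ℂ H) (x : H) :
    Tendsto (fun n => ∑ k ∈ Finset.range n, ⟪b k, x⟫_ℂ • b k) atTop (nhds x) := by
  have h := (b.hasSum_repr x).tendsto_sum_nat
  simpa only [b.repr_apply_apply] using h

theorem HilbertBasis.norm_sub_sum_range_le (e : HilbertBasis ℕ ℂ H) (n : ℕ) (h : H) :
    ‖h - ∑ k ∈ Finset.range n, ⟪e k, h⟫_ℂ • e k‖ ≤ ‖h‖ := by
  refine le_of_sq_le_sq ?_ (norm_nonneg _)
  refine hasSum_le (fun i => ?_) (e.hasSum_norm_inner_sq _) (e.hasSum_norm_inner_sq h)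
  rw [inner_sub_right]
  by_cases hi : i ∈ Finset.range n
  · rw [e.orthonormal.inner_right_sum _ hi, sub_self]
    simp
  · have h0 : ⟪e i, ∑ k ∈ Finset.range n, ⟪e k, h⟫_ℂ • e k⟫_ℂ = 0 := by
      rw [inner_sum]
      refine Finset.sum_eq_zero fun k hk => ?_
      rw [inner_smul_right, e.orthonormal.2 (fun hik : i = k => hi (hik ▸ hk)), mul_zero]
    rw [h0, sub_zero]

end HilbertBasis

/-- A bounded operator whose range lies, with norm control, in that of a compact operator is
compact. -/
theorem isCompactOperator_of_forall_exists {E F E' : Type*} [NormedAddCommGroup E]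
    [NormedSpace ℂ E] [NormedAddCommGroup F] [NormedSpace ℂ F] [NormedAddCommGroup E']
    [NormedSpace ℂ E'] (K : E' →L[ℂ] F) (hK : IsCompactOperator K) (L : E →L[ℂ] F) {C : ℝ}
    (h : ∀ x, ∃ y, K y = L x ∧ ‖y‖ ≤ C * ‖x‖) : IsCompactOperator L := by
  obtain ⟨S, hS, hsub⟩ :=
    hK.image_closedBall_subset_compact (𝕜₁ := ℂ) (f := (K : E' →ₗ[ℂ] F)) (|C| * 1)
  refine (isCompactOperator_iff_exists_mem_nhds_image_subset_compact _).2
    ⟨_, Metric.closedBall_mem_nhds (0 : E) one_pos, S, hS, ?_⟩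
  rintro _ ⟨x, hx, rfl⟩
  obtain ⟨y, hy, hyx⟩ := h x
  refine hsub ⟨y, ?_, hy⟩
  rw [mem_closedBall_zero_iff] at hx ⊢
  calc ‖y‖ ≤ C * ‖x‖ := hyx
    _ ≤ |C| * ‖x‖ := mul_le_mul_of_nonneg_right (le_abs_self C) (norm_nonneg _)
    _ ≤ |C| * 1 := mul_le_mul_of_nonneg_left hx (abs_nonneg C)

namespace PosDefOperator

variable {H : Type*} [NormedAddCommGroup H] [InnerProductSpace ℂ H] [CompleteSpace H]
  {G : Type*} [NormedAddCommGroup G] [InnerProductSpace ℂ G] [CompleteSpace G]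

theorem IsEigensystem.inner_invPow_right {A : PosDefOperator H} {lam : ℕ → ℝ} {u : ℕ → H}
    (hu : A.IsEigensystem lam u) {τ : ℝ} (hτ : 0 ≤ τ) (i : ℕ) (x : H) :
    ⟪u i, A.invPow τ x⟫_ℂ = ((lam i ^ (-τ) : ℝ) : ℂ) * ⟪u i, x⟫_ℂ := by
  rw [← A.inner_invPow, hu.invPow_apply hτ, inner_smul_left, Complex.conj_ofReal]

/-- The Heinz inequality for two operators with discrete spectrum: a bounded `J` that maps
`𝒟(M^ρ)` boundedly into `𝒟(A^ρ)` maps `𝒟(M^τ)` boundedly into `𝒟(A^τ)` for `0 ≤ τ ≤ ρ`. -/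
theorem exists_invPow_eq_of_le (A : PosDefOperator H) (M : PosDefOperator G) (J : G →L[ℂ] H)
    {μ : ℕ → ℝ} {lam : ℕ → ℝ} (e : HilbertBasis ℕ ℂ G) (u : HilbertBasis ℕ ℂ H)
    (he : M.IsEigensystem μ e) (hu : A.IsEigensystem lam u) {ρ τ : ℝ} (hρ : 0 < ρ) (hτ : 0 ≤ τ)
    (hτρ : τ ≤ ρ) {C₁ : ℝ}
    (h₁ : ∀ h, ∃ g, A.invPow ρ g = J (M.invPow ρ h) ∧ ‖g‖ ≤ C₁ * ‖h‖) :
    ∃ C : ℝ, 0 ≤ C ∧ ∀ h, ∃ g, A.invPow τ g = J (M.invPow τ h) ∧ ‖g‖ ≤ C * ‖h‖ := by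
  set C := max ‖J‖ C₁ with hCdef
  have hC : 0 ≤ C := (norm_nonneg J).trans (le_max_left _ _)
  refine ⟨C, hC, fun h => ?_⟩
  have hlam : ∀ i, 0 < lam i := hu.pos
  have hμ : ∀ k, 0 < μ k := he.pos
  -- the coefficients of `A^s J M^{-s}` applied to a finite combination of the `e k`
  have hcoeff : ∀ (s : ℝ), 0 ≤ s → ∀ (N : ℕ) (c : Fin N → ℂ) (i : ℕ),
      ∑ k : Fin N, ⟪u i, J (e k)⟫_ℂ * (((μ k ^ (-s) : ℝ) : ℂ) * c k) =
        ⟪u i, J (M.invPow s (∑ k, c k • e k))⟫_ℂ := by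
    intro s hs N c i
    rw [map_sum, map_sum, inner_sum]
    refine Finset.sum_congr rfl fun k _ => ?_
    rw [map_smul, he.invPow_apply hs, map_smul, map_smul, inner_smul_right, inner_smul_right]
    ring
  have hnorm : ∀ (N : ℕ) (c : Fin N → ℂ), ‖∑ k, c k • e k‖ ^ 2 = ∑ k, ‖c k‖ ^ 2 := by
    intro N c
    have ho : Orthonormal ℂ fun k : Fin N => e k := e.orthonormal.comp _ Fin.val_injective
    have h2 := ho.inner_sum c c Finset.univ
    rw [inner_self_eq_norm_sq_to_K] at h2
    simp only [RCLike.conj_mul] at h2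
    exact_mod_cast h2
  have hfin : ∀ (m N : ℕ) (c : Fin N → ℂ), ∑ i : Fin m,
      ‖((lam i ^ τ : ℝ) : ℂ) * ⟪u i, J (M.invPow τ (∑ k, c k • e k))⟫_ℂ‖ ^ 2 ≤
        C ^ 2 * ‖∑ k, c k • e k‖ ^ 2 := by
    intro m N c
    have hbessel : ∀ x : H, ∑ i : Fin m, ‖⟪u i, x⟫_ℂ‖ ^ 2 ≤ ‖x‖ ^ 2 := fun x =>
      (u.orthonormal.comp (fun i : Fin m => (i : ℕ)) Fin.val_injective).sum_inner_products_le
        (s := Finset.univ) x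
    have key := sum_norm_sq_rpow_weight_le (fun (i : Fin m) (k : Fin N) => ⟪u i, J (e k)⟫_ℂ)
      (a := fun i => lam i ^ ρ) (d := fun k => μ k ^ (-ρ)) (fun i => Real.rpow_pos_of_pos (hlam i) _)
      (fun k => Real.rpow_pos_of_pos (hμ k) _) hC ?_ ?_ (θ := τ / ρ)
      ⟨by positivity, (div_le_one hρ).2 hτρ⟩ c
    · have e1 : ∀ {x : ℝ}, 0 < x → (x ^ ρ) ^ (τ / ρ) = x ^ τ := fun hx => by
        rw [← Real.rpow_mul hx.le, mul_div_cancel₀ _ hρ.ne']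
      have e2 : ∀ {x : ℝ}, 0 < x → (x ^ (-ρ)) ^ (τ / ρ) = x ^ (-τ) := fun hx => by
        rw [← Real.rpow_mul hx.le, neg_mul, mul_div_cancel₀ _ hρ.ne']
      simp only [e1 (hlam _), e2 (hμ _), hcoeff τ hτ] at key
      rw [hnorm]
      exact key
    · intro c
      have e0 := fun i => hcoeff 0 le_rfl N c i
      simp only [neg_zero, Real.rpow_zero, Complex.ofReal_one, one_mul] at e0
      simp only [e0]
      refine (hbessel _).trans ?_
      rw [← hnorm, ← mul_pow, M.invPow_zero]
      refine pow_le_pow_left₀ (norm_nonneg _) ((J.le_opNorm _).trans ?_) 2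
      exact mul_le_mul_of_nonneg_right (le_max_left _ _) (norm_nonneg _)
    · intro c
      simp only [hcoeff ρ hρ.le]
      obtain ⟨g, hg, hgn⟩ := h₁ (∑ k, c k • e k)
      have e1 : ∀ i : ℕ, ((lam i ^ ρ : ℝ) : ℂ) * ⟪u i, J (M.invPow ρ (∑ k, c k • e k))⟫_ℂ =
          ⟪u i, g⟫_ℂ := by
        intro i
        rw [← hg, hu.inner_invPow_right hρ.le, ← mul_assoc, ← Complex.ofReal_mul,
          ← Real.rpow_add (hlam i), add_neg_cancel, Real.rpow_zero, Complex.ofReal_one, one_mul]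
      simp only [e1]
      refine (hbessel _).trans ?_
      rw [← hnorm, ← mul_pow]
      exact pow_le_pow_left₀ (norm_nonneg _)
        (hgn.trans (mul_le_mul_of_nonneg_right (le_max_right _ _) (norm_nonneg _))) 2
  have hall : ∀ m : ℕ, ∑ i ∈ Finset.range m,
      ‖((lam i ^ τ : ℝ) : ℂ) * ⟪u i, J (M.invPow τ h)⟫_ℂ‖ ^ 2 ≤ (C * ‖h‖) ^ 2 := by
    intro m
    have hlim := e.tendsto_sum_range h
    have hL : Continuous fun x : G => ∑ i ∈ Finset.range m,
        ‖((lam i ^ τ : ℝ) : ℂ) * ⟪u i, J (M.invPow τ x)⟫_ℂ‖ ^ 2 := by fun_prop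
    refine le_of_tendsto_of_tendsto' ((hL.tendsto h).comp hlim)
      (((continuous_const (y := C)).mul continuous_norm).pow 2 |>.tendsto h |>.comp hlim) ?_
    intro N
    have := hfin m N fun k => ⟪e k, h⟫_ℂ
    simp only [Function.comp, mul_pow]
    rw [Finset.sum_range, Finset.sum_range]
    exact this
  obtain ⟨g, hg, hgn⟩ := u.exists_inner_eq (by positivity) hall
  refine ⟨g, u.ext_inner fun i => ?_, hgn⟩
  rw [hu.inner_invPow_right hτ, hg, ← mul_assoc, ← Complex.ofReal_mul, ← Real.rpow_add (hlam i),
    neg_add_cancel, Real.rpow_zero, Complex.ofReal_one, one_mul]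

end PosDefOperator

/-! ### Projections and Ritz pairs for a diagonal operator -/

section Orthogonality

variable {H : Type*} [NormedAddCommGroup H] [InnerProductSpace ℂ H]

theorem norm_sq_sum_smul_of_orthogonal {κ : Type*} [Fintype κ] [DecidableEq κ] {Z : κ → H}
    {r : κ → ℝ} (h : ∀ i k, ⟪Z i, Z k⟫_ℂ = if i = k then (r i : ℂ) else 0) (b : κ → ℂ) :
    ‖∑ k, b k • Z k‖ ^ 2 = ∑ k, r k * ‖b k‖ ^ 2 := by
  have h1 : ⟪∑ k, b k • Z k, ∑ k, b k • Z k⟫_ℂ = ∑ k, (r k : ℂ) * (‖b k‖ : ℂ) ^ 2 := by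
    rw [sum_inner]
    refine Finset.sum_congr rfl fun i _ => ?_
    rw [inner_sum]
    simp only [inner_smul_left, inner_smul_right, h]
    rw [Finset.sum_eq_single i]
    · simp only [if_true]
      rw [mul_left_comm, ← mul_assoc, Complex.conj_mul', mul_comm]
    · intro k _ hk
      simp [hk.symm]
    · simp
  rw [inner_self_eq_norm_sq_to_K] at h1
  refine Complex.ofReal_injective ?_
  push_cast
  exact h1

/-- There are fewer conditions than coefficients. -/
theorem exists_sum_smul_eq_zero {j : ℕ} (y : Fin (j + 1) → H) (φ : Fin j → H →ₗ[ℂ] ℂ) :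
    ∃ b : Fin (j + 1) → ℂ, b ≠ 0 ∧ ∀ i, φ i (∑ k, b k • y k) = 0 := by
  let L : (Fin (j + 1) → ℂ) →ₗ[ℂ] (Fin j → ℂ) :=
    (LinearMap.pi φ) ∘ₗ Fintype.linearCombination ℂ y
  have hL : LinearMap.ker L ≠ ⊥ := LinearMap.ker_ne_bot_of_finrank_lt (by simp)
  obtain ⟨b, hb, hb0⟩ := (Submodule.ne_bot_iff _).1 hL
  refine ⟨b, hb0, fun i => ?_⟩
  have h := congrFun (LinearMap.mem_ker.1 hb) i
  simpa [L, Fintype.linearCombination_apply] using h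

theorem sum_norm_sq_pos {κ : Type*} [Fintype κ] {b : κ → ℂ} (hb : b ≠ 0) :
    0 < ∑ k, ‖b k‖ ^ 2 := by
  obtain ⟨k, hk⟩ := Function.ne_iff.1 hb
  have hk' : 0 < ‖b k‖ := norm_pos_iff.2 hk
  exact Finset.sum_pos' (fun _ _ => by positivity) ⟨k, Finset.mem_univ k, by positivity⟩

variable (V : Submodule ℂ H) [V.HasOrthogonalProjection]

theorem inner_sub_starProjection_eq (f y : H) :
    ⟪f - V.starProjection f, y⟫_ℂ = ⟪f - V.starProjection f, y - V.starProjection y⟫_ℂ := by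
  rw [inner_sub_right _ y, Submodule.inner_left_of_mem_orthogonal
    (V.starProjection_apply_mem y) (V.sub_starProjection_mem_orthogonal f), sub_zero]

theorem norm_sub_starProjection_le (f : H) : ‖f - V.starProjection f‖ ≤ ‖f‖ := by
  have h := Submodule.norm_sq_eq_add_norm_sq_starProjection f V
  rw [Submodule.starProjection_orthogonal_val] at h
  exact le_of_sq_le_sq (by nlinarith [norm_nonneg (V.starProjection f)]) (norm_nonneg f)

theorem norm_sub_starProjection_le_of_mem {v : H} (hv : v ∈ V) (f : H) :
    ‖f - V.starProjection f‖ ≤ ‖f - v‖ := by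
  have h := norm_sub_starProjection_le V (f - v)
  rwa [map_sub, Submodule.starProjection_eq_self_iff.2 hv, sub_sub_sub_cancel_right] at h

/-- The Aubin-Nitsche duality argument: an approximation property of the range of a symmetric `S`
improves the estimate of the error of an orthogonal projection in the norm `‖S ·‖`. -/
theorem norm_apply_sub_starProjection_le {S : H →L[ℂ] H} (hS : ∀ x y, ⟪S x, y⟫_ℂ = ⟪x, S y⟫_ℂ)
    {K : ℝ} (hK : ∀ g, ‖S g - V.starProjection (S g)‖ ≤ K * ‖g‖) (f : H) :
    ‖S (f - V.starProjection f)‖ ≤ K * ‖f - V.starProjection f‖ := by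
  set w := f - V.starProjection f with hw
  have h1 : ‖S w‖ ^ 2 ≤ ‖w‖ * (K * ‖S w‖) := by
    rw [← inner_self_eq_norm_sq (𝕜 := ℂ), hS]
    conv_lhs => rw [hw, inner_sub_starProjection_eq]
    exact (re_inner_le_norm _ _).trans (mul_le_mul_of_nonneg_left (hK _) (norm_nonneg _))
  rcases (norm_nonneg (S w)).eq_or_lt with h0 | h0
  · rw [← h0]
    by_contra hcon
    push Not at hcon
    have h2 := (norm_nonneg _).trans (hK w)
    linarith
  · refine le_of_mul_le_mul_right ?_ h0
    linarith

end Orthogonality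

section Diagonal

variable {H : Type*} [NormedAddCommGroup H] [InnerProductSpace ℂ H] {S : H →L[ℂ] H}
  {u : HilbertBasis ℕ ℂ H} {s : ℕ → ℝ}

theorem inner_apply_eq_mul (hS : ∀ x y, ⟪S x, y⟫_ℂ = ⟪x, S y⟫_ℂ)
    (hu : ∀ i, S (u i) = (s i : ℂ) • u i) (i : ℕ) (x : H) :
    ⟪u i, S x⟫_ℂ = (s i : ℂ) * ⟪u i, x⟫_ℂ := by
  rw [← hS, hu, inner_smul_left, Complex.conj_ofReal]

theorem norm_inner_apply_sq (hS : ∀ x y, ⟪S x, y⟫_ℂ = ⟪x, S y⟫_ℂ)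
    (hu : ∀ i, S (u i) = (s i : ℂ) • u i) (i : ℕ) (x : H) :
    ‖⟪u i, S x⟫_ℂ‖ ^ 2 = s i ^ 2 * ‖⟪u i, x⟫_ℂ‖ ^ 2 := by
  rw [inner_apply_eq_mul hS hu, norm_mul, mul_pow, Complex.norm_real, Real.norm_eq_abs, sq_abs]

theorem norm_apply_sq_le_of_inner_eq_zero (hS : ∀ x y, ⟪S x, y⟫_ℂ = ⟪x, S y⟫_ℂ)
    (hu : ∀ i, S (u i) = (s i : ℂ) • u i) (hs : ∀ i, 0 < s i) (hanti : Antitone s) {j : ℕ} {x : H}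
    (hx : ∀ i < j, ⟪u i, x⟫_ℂ = 0) : ‖S x‖ ^ 2 ≤ s j ^ 2 * ‖x‖ ^ 2 := by
  refine hasSum_le (fun i => ?_) (u.hasSum_norm_inner_sq (S x))
    ((u.hasSum_norm_inner_sq x).mul_left (s j ^ 2))
  rw [norm_inner_apply_sq hS hu]
  rcases lt_or_ge i j with h | h
  · simp [hx i h]
  · exact mul_le_mul_of_nonneg_right (pow_le_pow_left₀ (hs i).le (hanti h) 2) (by positivity)

/-- A value of a positive antitone sequence is isolated among all values. -/
theorem exists_gap_of_antitone (hs : ∀ i, 0 < s i) (hanti : Antitone s) (j : ℕ) :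
    ∃ g : ℝ, 0 < g ∧ ∀ i, s i ≠ s j → 2 * g ≤ |s i ^ 2 - s j ^ 2| := by
  obtain ⟨g₁, hg₁, h₁⟩ : ∃ g : ℝ, 0 < g ∧ ∀ i, s i < s j → g ≤ s j ^ 2 - s i ^ 2 := by
    by_cases hex : ∃ i, s i < s j
    · classical
      refine ⟨s j ^ 2 - s (Nat.find hex) ^ 2, ?_, fun i hi => ?_⟩
      · exact sub_pos.2 (pow_lt_pow_left₀ (Nat.find_spec hex) (hs _).le two_ne_zero)
      · exact sub_le_sub_left (pow_le_pow_left₀ (hs i).le (hanti (Nat.find_min' hex hi)) 2) _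
    · push Not at hex
      exact ⟨1, one_pos, fun i hi => absurd hi (not_lt.2 (hex i))⟩
  obtain ⟨g₂, hg₂, h₂⟩ : ∃ g : ℝ, 0 < g ∧ ∀ i, s j < s i → g ≤ s i ^ 2 - s j ^ 2 := by
    classical
    by_cases hex : ((Finset.range j).filter fun i => s j < s i).Nonempty
    · obtain ⟨k, hk, hmin⟩ := Finset.exists_min_image _ s hex
      have hk' := (Finset.mem_filter.1 hk).2
      refine ⟨s k ^ 2 - s j ^ 2, ?_, fun i hi => ?_⟩
      · exact sub_pos.2 (pow_lt_pow_left₀ hk' (hs _).le two_ne_zero)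
      · have hij : i < j := by
          by_contra hcon
          exact absurd hi (not_lt.2 (hanti (not_lt.1 hcon)))
        exact sub_le_sub_right (pow_le_pow_left₀ (hs k).le
          (hmin i (Finset.mem_filter.2 ⟨Finset.mem_range.2 hij, hi⟩)) 2) _
    · refine ⟨1, one_pos, fun i hi => absurd ?_ hex⟩
      refine ⟨i, Finset.mem_filter.2 ⟨Finset.mem_range.2 ?_, hi⟩⟩
      by_contra hcon
      exact absurd hi (not_lt.2 (hanti (not_lt.1 hcon)))
  refine ⟨min g₁ g₂ / 2, by positivity, fun i hi => ?_⟩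
  rw [mul_div_cancel₀ _ two_ne_zero]
  rcases lt_or_gt_of_ne hi with h | h
  · rw [abs_sub_comm]
    exact (min_le_left _ _).trans ((h₁ i h).trans (le_abs_self _))
  · exact (min_le_right _ _).trans ((h₂ i h).trans (le_abs_self _))

end Diagonal

section Ritz

variable {H : Type*} [NormedAddCommGroup H] [InnerProductSpace ℂ H]

/-- Rayleigh-Ritz pairs in `V` for the quotient `‖x‖² / ‖S x‖²`: stationary values `Λ i`, in
increasing order, and stationary vectors `X i` that are orthonormal for `⟪S ·, S ·⟫` and
span `V`. -/
structure IsRitzSystem (S : H →L[ℂ] H) (V : Submodule ℂ H) {n : ℕ} (Λ : Fin n → ℝ)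
    (X : Fin n → H) : Prop where
  mono : Monotone Λ
  mem : ∀ i, X i ∈ V
  le_span : V ≤ Submodule.span ℂ (Set.range X)
  orthonormal : ∀ i k, ⟪S (X i), S (X k)⟫_ℂ = if i = k then 1 else 0
  stationary : ∀ i, ∀ w ∈ V, ⟪w, X i⟫_ℂ = (Λ i : ℂ) * ⟪S w, S (X i)⟫_ℂ

variable {S : H →L[ℂ] H} {u : HilbertBasis ℕ ℂ H} {s : ℕ → ℝ} {V : Submodule ℂ H} {n : ℕ}
  {Λ : Fin n → ℝ} {X : Fin n → H}

namespace IsRitzSystem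

theorem inner_eq (h : IsRitzSystem S V Λ X) (i k : Fin n) :
    ⟪X i, X k⟫_ℂ = if i = k then (Λ i : ℂ) else 0 := by
  rw [h.stationary k _ (h.mem i), h.orthonormal]
  by_cases hik : i = k
  · simp [hik]
  · simp [hik]

/-- The Ritz values are upper bounds: with `λ_j = 1 / s_j²`, `λ_j ≤ Λ_j`. -/
theorem one_le_mul (h : IsRitzSystem S V Λ X) (hS : ∀ x y, ⟪S x, y⟫_ℂ = ⟪x, S y⟫_ℂ)
    (hu : ∀ i, S (u i) = (s i : ℂ) • u i) (hs : ∀ i, 0 < s i) (hanti : Antitone s) (j : Fin n) :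
    1 ≤ s j ^ 2 * Λ j := by
  let ι : Fin (j + 1) → Fin n := Fin.castLE j.2
  have hι : ∀ i k : Fin (j + 1), ι i = ι k ↔ i = k := fun i k =>
    (Fin.castLE_injective j.2).eq_iff
  -- a combination of the first `j + 1` Ritz vectors orthogonal to the first `j` eigenvectors
  obtain ⟨b, hb0, hb⟩ := exists_sum_smul_eq_zero (fun k => X (ι k))
    fun i : Fin j => (innerSL ℂ (u i) : H →ₗ[ℂ] ℂ)
  set x := ∑ k, b k • X (ι k) with hx
  have hSx : ‖S x‖ ^ 2 = ∑ k, ‖b k‖ ^ 2 := by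
    rw [hx, map_sum]
    simp only [map_smul]
    rw [norm_sq_sum_smul_of_orthogonal (r := fun _ => 1)]
    · simp
    · intro i k
      simp [h.orthonormal, hι]
  have hxn : ‖x‖ ^ 2 = ∑ k, Λ (ι k) * ‖b k‖ ^ 2 :=
    norm_sq_sum_smul_of_orthogonal (fun i k => by simp [h.inner_eq, hι]) b
  have h1 : ‖x‖ ^ 2 ≤ Λ j * ‖S x‖ ^ 2 := by
    rw [hxn, hSx, Finset.mul_sum]
    refine Finset.sum_le_sum fun k _ => mul_le_mul_of_nonneg_right (h.mono ?_) (by positivity)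
    exact Fin.le_def.2 (Nat.lt_succ_iff.1 k.2)
  have h2 : ‖S x‖ ^ 2 ≤ s j ^ 2 * ‖x‖ ^ 2 :=
    norm_apply_sq_le_of_inner_eq_zero hS hu hs hanti fun i hi => hb ⟨i, hi⟩
  have h3 : 0 < ‖S x‖ ^ 2 := hSx ▸ sum_norm_sq_pos hb0
  have h4 : 1 * ‖S x‖ ^ 2 ≤ s j ^ 2 * Λ j * ‖S x‖ ^ 2 := by
    rw [one_mul, mul_assoc]
    exact h2.trans (mul_le_mul_of_nonneg_left h1 (by positivity))
  exact le_of_mul_le_mul_right h4 h3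

theorem value_pos (h : IsRitzSystem S V Λ X) (hS : ∀ x y, ⟪S x, y⟫_ℂ = ⟪x, S y⟫_ℂ)
    (hu : ∀ i, S (u i) = (s i : ℂ) • u i) (hs : ∀ i, 0 < s i) (hanti : Antitone s) (j : Fin n) :
    0 < Λ j := by
  have h1 := h.one_le_mul hS hu hs hanti j
  have h2 := hs j
  by_contra hcon
  nlinarith [mul_nonneg (sq_nonneg (s j)) (neg_nonneg.2 (not_lt.1 hcon))]

/-- The min-max principle, applied to the projections of the first eigenvectors, bounds the
Ritz values in terms of the squares of the projection errors. -/
theorem mul_le_one [V.HasOrthogonalProjection] (h : IsRitzSystem S V Λ X)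
    (hS : ∀ x y, ⟪S x, y⟫_ℂ = ⟪x, S y⟫_ℂ)
    (hu : ∀ i, S (u i) = (s i : ℂ) • u i) (hs : ∀ i, 0 < s i) (hanti : Antitone s) (j : Fin n) :
    Λ j * (s j ^ 2 - 2 * s 0 ^ 2 *
      (∑ k : Fin (j + 1), ‖u k - V.starProjection (u k)‖) ^ 2) ≤ 1 := by
  set ε := ∑ k : Fin (j + 1), ‖u k - V.starProjection (u k)‖ with hε
  have hΛ := h.value_pos hS hu hs hanti j
  obtain ⟨b, hb0, hb⟩ := exists_sum_smul_eq_zero (fun k : Fin (j + 1) => u k)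
    fun i : Fin j => ((innerSL ℂ (S (X ⟨i, i.2.trans j.2⟩))).comp
      (S.comp V.starProjection) : H →ₗ[ℂ] ℂ)
  set x := ∑ k : Fin (j + 1), b k • u k with hx
  have hui : ∀ i k : Fin (j + 1), ⟪u i, u k⟫_ℂ = if i = k then 1 else 0 := fun i k => by
    simp [orthonormal_iff_ite.1 u.orthonormal, Fin.val_inj]
  have hxn : ‖x‖ ^ 2 = ∑ k, ‖b k‖ ^ 2 := by
    rw [hx, norm_sq_sum_smul_of_orthogonal (r := fun _ => 1)]
    · simp
    · intro i k
      simpa using hui i k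
  have hxpos : 0 < ‖x‖ ^ 2 := hxn ▸ sum_norm_sq_pos hb0
  have hbx : ∀ k, ‖b k‖ ≤ ‖x‖ := fun k => le_of_sq_le_sq
    (hxn ▸ Finset.single_le_sum (f := fun k => ‖b k‖ ^ 2) (fun _ _ => by positivity)
      (Finset.mem_univ k)) (norm_nonneg x)
  have hSx : s j ^ 2 * ‖x‖ ^ 2 ≤ ‖S x‖ ^ 2 := by
    have e : S x = ∑ k : Fin (j + 1), ((s k : ℂ) * b k) • u k := by
      rw [hx, map_sum]
      refine Finset.sum_congr rfl fun k _ => ?_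
      rw [map_smul, hu, smul_smul, mul_comm]
    rw [hxn, e, norm_sq_sum_smul_of_orthogonal (r := fun _ => 1) (by simpa using hui),
      Finset.mul_sum]
    refine Finset.sum_le_sum fun k _ => ?_
    rw [norm_mul, mul_pow, one_mul, Complex.norm_real, Real.norm_of_nonneg (hs _).le]
    exact mul_le_mul_of_nonneg_right
      (pow_le_pow_left₀ (hs _).le (hanti (Nat.lt_succ_iff.1 k.2)) 2) (by positivity)
  -- the error for a combination of the eigenvectors
  have herr : ∀ (c : Fin (j + 1) → ℂ) (R : ℝ), (∀ k, ‖c k‖ ≤ R) →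
      ‖(∑ k, c k • u k) - V.starProjection (∑ k, c k • u k)‖ ≤ R * ε := by
    intro c R hc
    rw [map_sum, ← Finset.sum_sub_distrib, hε, Finset.mul_sum]
    refine (norm_sum_le _ _).trans (Finset.sum_le_sum fun k _ => ?_)
    rw [map_smul, ← smul_sub, norm_smul]
    exact mul_le_mul_of_nonneg_right (hc k) (norm_nonneg _)
  have herr1 : ‖x - V.starProjection x‖ ≤ ‖x‖ * ε := herr b _ hbx
  have herr2 : ‖S (S x) - V.starProjection (S (S x))‖ ≤ s 0 ^ 2 * ‖x‖ * ε := by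
    have e : S (S x) = ∑ k : Fin (j + 1), ((s k : ℂ) ^ 2 * b k) • u k := by
      rw [hx, map_sum, map_sum]
      refine Finset.sum_congr rfl fun k _ => ?_
      rw [map_smul, hu, map_smul, map_smul, hu, smul_smul, smul_smul]
      congr 1
      ring
    rw [e]
    refine herr _ _ fun k => ?_
    rw [norm_mul, norm_pow, Complex.norm_real, Real.norm_of_nonneg (hs _).le]
    exact mul_le_mul (pow_le_pow_left₀ (hs _).le (hanti (Nat.zero_le _)) 2) (hbx k)
      (norm_nonneg _) (by positivity)
  -- `‖S P x‖² ≥ ‖S x‖² - 2 Re ⟪S x, S (x - P x)⟫`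
  have hSP : ‖S x‖ ^ 2 - 2 * (s 0 ^ 2 * ‖x‖ * ε * (‖x‖ * ε)) ≤ ‖S (V.starProjection x)‖ ^ 2 := by
    have e : S (V.starProjection x) = S x - S (x - V.starProjection x) := by
      rw [map_sub, sub_sub_cancel]
    rw [e, norm_sub_sq (𝕜 := ℂ)]
    have h1 : RCLike.re ⟪S x, S (x - V.starProjection x)⟫_ℂ ≤
        s 0 ^ 2 * ‖x‖ * ε * (‖x‖ * ε) := by
      rw [← inner_re_symm, hS, inner_sub_starProjection_eq, mul_comm]
      exact (re_inner_le_norm _ _).trans (mul_le_mul herr1 herr2 (norm_nonneg _) (by positivity))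
    nlinarith [sq_nonneg ‖S (x - V.starProjection x)‖]
  obtain ⟨c, hc⟩ := (Submodule.mem_span_range_iff_exists_fun ℂ).1
    (h.le_span (V.starProjection_apply_mem x))
  have hPS : ‖S (V.starProjection x)‖ ^ 2 = ∑ k, ‖c k‖ ^ 2 := by
    rw [← hc, map_sum]
    simp only [map_smul]
    rw [norm_sq_sum_smul_of_orthogonal (r := fun _ => 1)]
    · simp
    · intro i k
      simp [h.orthonormal]
  have hP : ‖V.starProjection x‖ ^ 2 = ∑ k, Λ k * ‖c k‖ ^ 2 := by
    rw [← hc]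
    exact norm_sq_sum_smul_of_orthogonal h.inner_eq c
  have hc0 : ∀ i : Fin n, i < j → c i = 0 := by
    intro i hi
    have h1 : ⟪S (X i), S (V.starProjection x)⟫_ℂ = 0 := hb ⟨i, hi⟩
    rw [← hc, map_sum, inner_sum] at h1
    simpa [inner_smul_right, h.orthonormal] using h1
  have hray : Λ j * ‖S (V.starProjection x)‖ ^ 2 ≤ ‖V.starProjection x‖ ^ 2 := by
    rw [hPS, hP, Finset.mul_sum]
    refine Finset.sum_le_sum fun k _ => ?_
    rcases lt_or_ge k j with hk | hk
    · simp [hc0 k hk]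
    · exact mul_le_mul_of_nonneg_right (h.mono hk) (by positivity)
  have hPx : ‖V.starProjection x‖ ^ 2 ≤ ‖x‖ ^ 2 :=
    pow_le_pow_left₀ (norm_nonneg _) (V.norm_starProjection_apply_le x) 2
  refine le_of_mul_le_mul_right (a := ‖x‖ ^ 2) ?_ hxpos
  have h5 := mul_le_mul_of_nonneg_left (hSx.trans (sub_le_iff_le_add.1 hSP)) hΛ.le
  nlinarith

end IsRitzSystem

/-- Splitting of a Ritz vector `x` into a part `y` in an eigenspace and a part `z` orthogonal to it.
As `(S² - Λ⁻¹) x = (1 - P) (S² - s_j²) z`, duality makes `‖S z‖` small compared with `‖z‖`. -/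
theorem exists_add_eigenvector_of_stationary [CompleteSpace H] [V.HasOrthogonalProjection]
    (hS : ∀ x y, ⟪S x, y⟫_ℂ = ⟪x, S y⟫_ℂ)
    (hu : ∀ i, S (u i) = (s i : ℂ) • u i) (hs : ∀ i, 0 < s i) {K : ℝ}
    (hK : ∀ g, ‖S g - V.starProjection (S g)‖ ≤ K * ‖g‖) {Λ : ℝ} {x : H} (hΛ : 0 < Λ) (hx : x ∈ V)
    (hstat : ∀ w ∈ V, ⟪w, x⟫_ℂ = (Λ : ℂ) * ⟪S w, S x⟫_ℂ) {j : ℕ} {g : ℝ}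
    (hg : 0 < g) (hgap : ∀ i, s i ≠ s j → g ≤ |s i ^ 2 - Λ⁻¹|) (hK0 : 0 ≤ K) :
    ∃ z y : H, x = z + y ∧ S y = (s j : ℂ) • y ∧ ⟪z, y⟫_ℂ = 0 ∧
      g * ‖S z‖ ≤ K * ((‖S‖ ^ 2 + s j ^ 2) * ‖z‖) := by
  set D := ‖S‖ ^ 2 + s j ^ 2 with hD
  have hsj := hs j
  let E : Submodule ℂ H := (S - (s j : ℂ) • (1 : H →L[ℂ] H)).ker
  have : CompleteSpace E := (S - (s j : ℂ) • (1 : H →L[ℂ] H)).isClosed_ker.completeSpace_coe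
  have hE : ∀ y ∈ E, S y = (s j : ℂ) • y := by
    intro y hy
    have h1 : (S - (s j : ℂ) • (1 : H →L[ℂ] H)) y = 0 := hy
    simpa [sub_eq_zero] using h1
  have huE : ∀ i, s i = s j → u i ∈ E := by
    intro i hi
    change (S - (s j : ℂ) • (1 : H →L[ℂ] H)) (u i) = 0
    simp [hu, hi]
  set y := E.starProjection x with hy
  set z := x - y with hz
  have hyE : y ∈ E := E.starProjection_apply_mem x
  have hzE : z ∈ Eᗮ := E.sub_starProjection_mem_orthogonal x
  have hSy := hE y hyE
  have hxyz : x = z + y := by rw [hz, sub_add_cancel]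
  have hzy : ⟪z, y⟫_ℂ = 0 := Submodule.inner_left_of_mem_orthogonal hyE hzE
  have hz0 : ∀ i, s i = s j → ⟪u i, z⟫_ℂ = 0 := fun i hi =>
    Submodule.inner_right_of_mem_orthogonal (huE i hi) hzE
  have hy0 : ∀ i, s i ≠ s j → ⟪u i, y⟫_ℂ = 0 := by
    intro i hi
    have h1 := inner_apply_eq_mul hS hu i y
    rw [hSy, inner_smul_right] at h1
    have h2 : ((s j : ℂ) - s i) * ⟪u i, y⟫_ℂ = 0 := by rw [sub_mul, h1, sub_self]
    refine (mul_eq_zero.1 h2).resolve_left fun h3 => hi ?_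
    exact_mod_cast (sub_eq_zero.1 h3).symm
  -- the residual of the Ritz vector
  set w := S (S z) - ((s j : ℂ) ^ 2) • z with hw
  have hres : S (S x) - ((Λ⁻¹ : ℝ) : ℂ) • x = w - V.starProjection w := by
    have hPx : V.starProjection x = x := Submodule.starProjection_eq_self_iff.2 hx
    have h1 : V.starProjection (S (S x)) = ((Λ⁻¹ : ℝ) : ℂ) • x := by
      refine Submodule.eq_starProjection_of_mem_orthogonal (V.smul_mem _ hx) ?_
      rw [Submodule.mem_orthogonal]
      intro v hv
      rw [inner_sub_right, inner_smul_right, hstat v hv, ← hS, ← mul_assoc, ← Complex.ofReal_mul,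
        inv_mul_cancel₀ hΛ.ne']
      simp
    have h2 : w = S (S x) - ((s j : ℂ) ^ 2) • x := by
      rw [hw, hxyz, map_add, map_add, hSy, map_smul, hSy, smul_add, smul_smul, ← pow_two]
      abel
    rw [h2, map_sub, map_smul, h1, hPx]
    abel
  have hwn : ‖w‖ ≤ D * ‖z‖ := by
    rw [hw, hD, add_mul]
    refine (norm_sub_le _ _).trans (add_le_add ?_ ?_)
    · rw [pow_two, mul_assoc]
      exact (S.le_opNorm _).trans (mul_le_mul_of_nonneg_left (S.le_opNorm _) (norm_nonneg _))
    · rw [norm_smul, norm_pow, Complex.norm_real, Real.norm_of_nonneg hsj.le]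
  have hSr : ‖S (w - V.starProjection w)‖ ≤ K * (D * ‖z‖) :=
    (norm_apply_sub_starProjection_le V hS hK w).trans
      (mul_le_mul_of_nonneg_left ((norm_sub_starProjection_le V w).trans hwn) hK0)
  have hgz : g * ‖S z‖ ≤ ‖S (w - V.starProjection w)‖ := by
    refine le_of_sq_le_sq ?_ (norm_nonneg _)
    rw [mul_pow]
    refine hasSum_le (fun i => ?_) ((u.hasSum_norm_inner_sq (S z)).mul_left (g ^ 2))
      (u.hasSum_norm_inner_sq _)
    by_cases hi : s i = s j
    · rw [norm_inner_apply_sq hS hu, hz0 i hi]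
      simp
    · have h1 : ⟪u i, w - V.starProjection w⟫_ℂ = ((s i ^ 2 - Λ⁻¹ : ℝ) : ℂ) * ⟪u i, z⟫_ℂ := by
        have h2 : ⟪u i, x⟫_ℂ = ⟪u i, z⟫_ℂ := by rw [hxyz, inner_add_right, hy0 i hi, add_zero]
        rw [← hres, inner_sub_right, inner_smul_right, inner_apply_eq_mul hS hu,
          inner_apply_eq_mul hS hu, h2]
        push_cast
        ring
      rw [norm_inner_apply_sq hS hu, norm_inner_apply_sq hS hu, h1, norm_mul, Complex.norm_real,
        Real.norm_eq_abs, mul_pow, mul_left_comm]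
      exact mul_le_mul_of_nonneg_left (mul_le_mul_of_nonneg_right
        (pow_le_pow_left₀ hg.le (hgap i hi) 2) (by positivity)) (by positivity)
  exact ⟨z, y, hxyz, hSy, hzy, hgz.trans hSr⟩

/-- A Ritz vector `x` is close to an eigenvector `Y`, the normalized part of `x` in the eigenspace:
the part `z` of `x` orthogonal to the eigenspace satisfies `‖z‖² = Λ - λ_j + λ_j ‖S z‖²` with
`λ_j = 1 / s_j²`, where the last term can be absorbed. -/
theorem exists_eigenvector_near [CompleteSpace H] [V.HasOrthogonalProjection]
    (hS : ∀ x y, ⟪S x, y⟫_ℂ = ⟪x, S y⟫_ℂ)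
    (hu : ∀ i, S (u i) = (s i : ℂ) • u i) (hs : ∀ i, 0 < s i) {K : ℝ}
    (hK : ∀ g, ‖S g - V.starProjection (S g)‖ ≤ K * ‖g‖) {Λ : ℝ} {x : H} (hΛ : 0 < Λ) (hx : x ∈ V)
    (hstat : ∀ w ∈ V, ⟪w, x⟫_ℂ = (Λ : ℂ) * ⟪S w, S x⟫_ℂ) (hx1 : ‖S x‖ = 1) {j : ℕ} {g : ℝ}
    (hg : 0 < g) (hgap : ∀ i, s i ≠ s j → g ≤ |s i ^ 2 - Λ⁻¹|) (hK0 : 0 ≤ K)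
    (hsmall : K * (‖S‖ ^ 2 + s j ^ 2) ≤ g * (s j / 2)) (hΛ2 : s j ^ 2 * Λ ≤ 2) :
    ∃ Y : H, S Y = (s j : ℂ) • Y ∧ ‖S Y‖ = 1 ∧ ‖Y - x‖ ^ 2 ≤ 3 * (Λ - (s j ^ 2)⁻¹) ∧
      ‖S (Y - x)‖ ^ 2 ≤ 8 * ((‖S‖ ^ 2 + s j ^ 2) / g) ^ 2 * K ^ 2 * (Λ - (s j ^ 2)⁻¹) := by
  obtain ⟨z, y, hxyz, hSy, hzy, hgz⟩ :=
    exists_add_eigenvector_of_stationary hS hu hs hK hΛ hx hstat hg hgap hK0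
  set D := ‖S‖ ^ 2 + s j ^ 2 with hD
  have hsj := hs j
  have hD0 : 0 < D := by positivity
  have hSz : ‖S z‖ ≤ K * (D / g) * ‖z‖ := by
    have h2 : K * (D / g) * ‖z‖ = (K * (D * ‖z‖)) / g := by ring
    rw [h2, le_div_iff₀ hg, mul_comm]
    exact hgz
  have hSz2 : ‖S z‖ ≤ s j / 2 * ‖z‖ := by
    refine hSz.trans (mul_le_mul_of_nonneg_right ?_ (norm_nonneg _))
    rw [← mul_div_assoc, div_le_iff₀ hg, mul_comm (s j / 2)]
    exact hsmall
  -- the identity `s_j² ‖z‖² = s_j² Λ - 1 + ‖S z‖²`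
  have hpyth : ‖x‖ ^ 2 = ‖z‖ ^ 2 + ‖y‖ ^ 2 := by
    rw [hxyz, norm_add_sq (𝕜 := ℂ), hzy]
    simp
  have hpyth' : 1 = ‖S z‖ ^ 2 + (s j * ‖y‖) ^ 2 := by
    have h1 : ⟪S z, S y⟫_ℂ = 0 := by
      rw [hS, hSy, map_smul, hSy, inner_smul_right, inner_smul_right, hzy]
      simp
    have h2 : ‖S x‖ ^ 2 = ‖S z‖ ^ 2 + ‖S y‖ ^ 2 := by
      rw [hxyz, map_add, norm_add_sq (𝕜 := ℂ), h1]
      simp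
    rw [hx1, hSy, norm_smul, Complex.norm_real, Real.norm_of_nonneg hsj.le] at h2
    linarith
  have hxΛ : ‖x‖ ^ 2 = Λ := by
    have h1 := hstat x hx
    rw [inner_self_eq_norm_sq_to_K, inner_self_eq_norm_sq_to_K, hx1] at h1
    simp only [RCLike.ofReal_one, one_pow, mul_one] at h1
    refine Complex.ofReal_injective ?_
    rw [Complex.ofReal_pow]
    exact h1
  set δ := Λ - (s j ^ 2)⁻¹ with hδ
  have hδ' : s j ^ 2 * δ = s j ^ 2 * Λ - 1 := by
    rw [hδ, mul_sub, mul_inv_cancel₀ (by positivity)]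
  have hΛz : Λ = ‖z‖ ^ 2 + ‖y‖ ^ 2 := hxΛ.symm.trans hpyth
  have hen : s j ^ 2 * ‖z‖ ^ 2 = s j ^ 2 * δ + ‖S z‖ ^ 2 := by
    rw [hδ', hΛz]
    linear_combination hpyth'
  have hSzsq : ‖S z‖ ^ 2 ≤ s j ^ 2 * ‖z‖ ^ 2 / 4 := by
    have h1 := pow_le_pow_left₀ (norm_nonneg _) hSz2 2
    linarith [h1.trans_eq (show (s j / 2 * ‖z‖) ^ 2 = s j ^ 2 * ‖z‖ ^ 2 / 4 by ring)]
  have hzδ : ‖z‖ ^ 2 ≤ 4 / 3 * δ := by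
    refine le_of_mul_le_mul_left (a := s j ^ 2) ?_ (by positivity)
    linarith
  have hSz1 : ‖S z‖ ^ 2 ≤ 1 / 3 := by
    linarith
  set ρ := s j * ‖y‖ with hρ
  have hρ0 : 0 < ρ := by
    have h1 : 0 ≤ ρ := by positivity
    refine lt_of_le_of_ne h1 fun h2 => ?_
    rw [← h2] at hpyth'
    linarith
  have hρ1 : ρ ≤ 1 := le_of_sq_le_sq (by linarith [sq_nonneg ‖S z‖]) zero_le_one
  have h1ρ : 1 - ρ ≤ ‖S z‖ := by
    have h1 : ‖S z‖ ≤ 1 := le_of_sq_le_sq (by linarith) zero_le_one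
    have h2 : 1 - ‖S z‖ ≤ ρ := by
      refine le_of_sq_le_sq ?_ hρ0.le
      nlinarith [mul_nonneg (norm_nonneg (S z)) (sub_nonneg.2 h1)]
    linarith
  have hdiff : ((ρ⁻¹ : ℝ) : ℂ) • y - x = ((ρ⁻¹ - 1 : ℝ) : ℂ) • y - z := by
    rw [hxyz]
    push_cast
    rw [sub_smul, one_smul]
    abel
  have hny : ‖((ρ⁻¹ - 1 : ℝ) : ℂ) • y‖ = (1 - ρ) / s j := by
    rw [norm_smul, Complex.norm_real, Real.norm_of_nonneg
      (sub_nonneg.2 ((one_le_inv₀ hρ0).2 hρ1)), eq_div_iff hsj.ne', mul_assoc, mul_comm ‖y‖, ← hρ,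
      sub_mul, inv_mul_cancel₀ hρ0.ne', one_mul]
  have hny' : ‖S (((ρ⁻¹ - 1 : ℝ) : ℂ) • y)‖ = 1 - ρ := by
    rw [map_smul, hSy, smul_comm, norm_smul, hny, Complex.norm_real, Real.norm_of_nonneg hsj.le,
      mul_div_cancel₀ _ hsj.ne']
  refine ⟨((ρ⁻¹ : ℝ) : ℂ) • y, ?_, ?_, ?_, ?_⟩
  · rw [map_smul, hSy, smul_comm]
  · rw [map_smul, hSy, norm_smul, norm_smul, Complex.norm_real, Complex.norm_real,
      Real.norm_of_nonneg hsj.le, Real.norm_of_nonneg (inv_nonneg.2 hρ0.le), ← hρ,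
      inv_mul_cancel₀ hρ0.ne']
  · have h1 : ‖((ρ⁻¹ : ℝ) : ℂ) • y - x‖ ≤ 3 / 2 * ‖z‖ := by
      rw [hdiff]
      refine (norm_sub_le _ _).trans ?_
      rw [hny]
      have h2 : (1 - ρ) / s j ≤ ‖z‖ / 2 := by
        rw [div_le_iff₀ hsj]
        linarith
      linarith
    calc _ ≤ (3 / 2 * ‖z‖) ^ 2 := pow_le_pow_left₀ (norm_nonneg _) h1 2
      _ = 9 / 4 * ‖z‖ ^ 2 := by ring
      _ ≤ 9 / 4 * (4 / 3 * δ) := by linarith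
      _ = 3 * δ := by ring
  · have h1 : ‖S (((ρ⁻¹ : ℝ) : ℂ) • y - x)‖ ≤ 2 * (K * (D / g) * ‖z‖) := by
      rw [hdiff, map_sub]
      refine (norm_sub_le _ _).trans ?_
      rw [hny']
      linarith
    have h3 := pow_le_pow_left₀ (norm_nonneg _) h1 2
    have h4 : 0 ≤ (D / g) ^ 2 * K ^ 2 := by positivity
    have h5 : 0 ≤ δ := by linarith [sq_nonneg ‖z‖]
    calc _ ≤ _ := h3
      _ = 4 * ((D / g) ^ 2 * K ^ 2) * ‖z‖ ^ 2 := by ring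
      _ ≤ 4 * ((D / g) ^ 2 * K ^ 2) * (2 * δ) :=
        mul_le_mul_of_nonneg_left (by linarith) (by positivity)
      _ = _ := by ring

end Ritz

/-! ### Convergence of Ritz pairs -/

section RitzAsymptotics

variable {H : Type*} [NormedAddCommGroup H] [InnerProductSpace ℂ H] [CompleteSpace H]
  {S : H →L[ℂ] H} {u : HilbertBasis ℕ ℂ H} {s : ℕ → ℝ}

/-- Convergence of the Ritz pairs when the first eigenvectors are approximated with errors
`o(r n)` and the approximation property of the range of `S` holds with constants `K n → 0`. -/
theorem exists_eigenvector_isLittleO (hS : ∀ x y, ⟪S x, y⟫_ℂ = ⟪x, S y⟫_ℂ)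
    (hu : ∀ i, S (u i) = (s i : ℂ) • u i) (hs : ∀ i, 0 < s i) (hanti : Antitone s)
    (V : ℕ → Submodule ℂ H) [∀ n, (V n).HasOrthogonalProjection] {Λ : ℕ → ℕ → ℝ} {X : ℕ → ℕ → H}
    (hR : ∀ n, IsRitzSystem S (V n) (fun k : Fin n => Λ n k) fun k : Fin n => X n k)
    {K : ℕ → ℝ} (hK : ∀ n g, ‖S g - (V n).starProjection (S g)‖ ≤ K n * ‖g‖)
    (hK0 : ∀ n, 0 ≤ K n) (hKlim : Tendsto K atTop (nhds 0)) {r : ℕ → ℝ}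
    (hr : r =O[atTop] fun _ => (1 : ℝ)) (j : ℕ)
    (herr : ∀ i ≤ j, (fun n => ‖u i - (V n).starProjection (u i)‖) =o[atTop] r) :
    ∃ Y : ℕ → H, (∀ n, S (Y n) = (s j : ℂ) • Y n ∧ ‖S (Y n)‖ = 1) ∧
      (fun n => Λ n j - (s j ^ 2)⁻¹) =o[atTop] (fun n => r n ^ 2) ∧
      (fun n => ‖Y n - X n j‖) =o[atTop] r ∧
      (fun n => ‖S (Y n - X n j)‖ ^ 2) =o[atTop] fun n => K n ^ 2 * r n ^ 2 := by
  have hsj := hs j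
  set ε : ℕ → ℝ := fun n => ∑ k : Fin (j + 1), ‖u k - (V n).starProjection (u k)‖ with hε
  have hεr : ε =o[atTop] r :=
    IsLittleO.fun_sum fun (k : Fin (j + 1)) _ => herr k (Nat.lt_succ_iff.1 k.2)
  set η : ℕ → ℝ := fun n => 2 * s 0 ^ 2 * ε n ^ 2 with hη
  have hηr : η =o[atTop] fun n => r n ^ 2 := (hεr.pow two_pos).const_mul_left _
  have hη0 : ∀ n, 0 ≤ η n := fun n => by positivity
  have hηlim : Tendsto η atTop (nhds 0) := by
    have h1 : (fun n => r n ^ 2) =O[atTop] fun _ => (1 : ℝ) := by simpa using hr.pow 2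
    exact (isLittleO_one_iff ℝ).1 (hηr.trans_isBigO h1)
  obtain ⟨g, hg, hgap⟩ := exists_gap_of_antitone hs hanti j
  have hlow : ∀ n, j < n → 1 ≤ s j ^ 2 * Λ n j := fun n hn =>
    (hR n).one_le_mul hS hu hs hanti ⟨j, hn⟩
  have hpos : ∀ n, j < n → 0 < Λ n j := fun n hn => (hR n).value_pos hS hu hs hanti ⟨j, hn⟩
  have hup : ∀ n, j < n → Λ n j * (s j ^ 2 - η n) ≤ 1 := fun n hn =>
    (hR n).mul_le_one hS hu hs hanti ⟨j, hn⟩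
  have hev1 : ∀ᶠ n in atTop, j < n := eventually_gt_atTop j
  have hev2 : ∀ᶠ n in atTop, η n ≤ s j ^ 2 / 2 :=
    hηlim.eventually (ge_mem_nhds (by positivity))
  have hev3 : ∀ᶠ n in atTop, η n ≤ g := hηlim.eventually (ge_mem_nhds hg)
  have hev4 : ∀ᶠ n in atTop, K n * (‖S‖ ^ 2 + s j ^ 2) ≤ g * (s j / 2) := by
    have h1 : Tendsto (fun n => K n * (‖S‖ ^ 2 + s j ^ 2)) atTop (nhds 0) := by
      simpa using hKlim.mul_const (‖S‖ ^ 2 + s j ^ 2)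
    exact h1.eventually (ge_mem_nhds (by positivity))
  have hΛ2 : ∀ᶠ n in atTop, s j ^ 2 * Λ n j ≤ 2 := by
    filter_upwards [hev1, hev2] with n h1 h2
    nlinarith [hup n h1, hpos n h1]
  have hval : ∀ᶠ n in atTop, 0 ≤ Λ n j - (s j ^ 2)⁻¹ ∧
      Λ n j - (s j ^ 2)⁻¹ ≤ 2 / s j ^ 4 * η n := by
    filter_upwards [hev1, hΛ2] with n h1 h2
    have e : Λ n j - (s j ^ 2)⁻¹ = (s j ^ 2 * Λ n j - 1) / s j ^ 2 := by
      field_simp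
    rw [e]
    refine ⟨div_nonneg (sub_nonneg.2 (hlow n h1)) (by positivity), ?_⟩
    rw [div_le_iff₀ (by positivity)]
    have e2 : 2 / s j ^ 4 * η n * s j ^ 2 = 2 / s j ^ 2 * η n := by
      field_simp
    have h3 : Λ n j ≤ 2 / s j ^ 2 := by
      rw [le_div_iff₀ (by positivity), mul_comm]
      exact h2
    rw [e2]
    nlinarith [hup n h1, mul_le_mul_of_nonneg_right h3 (hη0 n)]
  have hvalo : (fun n => Λ n j - (s j ^ 2)⁻¹) =o[atTop] fun n => r n ^ 2 := by
    refine IsBigO.trans_isLittleO (IsBigO.of_bound (2 / s j ^ 4) ?_) hηr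
    filter_upwards [hval] with n hn
    rw [Real.norm_of_nonneg hn.1, Real.norm_of_nonneg (hη0 n)]
    exact hn.2
  have hnear : ∀ᶠ n in atTop, ∃ Y : H, S Y = (s j : ℂ) • Y ∧ ‖S Y‖ = 1 ∧
      ‖Y - X n j‖ ^ 2 ≤ 3 * (Λ n j - (s j ^ 2)⁻¹) ∧ ‖S (Y - X n j)‖ ^ 2 ≤
        8 * ((‖S‖ ^ 2 + s j ^ 2) / g) ^ 2 * K n ^ 2 * (Λ n j - (s j ^ 2)⁻¹) := by
    filter_upwards [hev1, hev3, hev4, hΛ2] with n h1 h3 h4 h5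
    have hX : ‖S (X n j)‖ = 1 := by
      have h6 := (hR n).orthonormal ⟨j, h1⟩ ⟨j, h1⟩
      rw [if_pos rfl] at h6
      rw [← sq_eq_sq₀ (norm_nonneg _) zero_le_one, ← inner_self_eq_norm_sq (𝕜 := ℂ), h6]
      simp
    refine exists_eigenvector_near hS hu hs (hK n) (hpos n h1) ((hR n).mem ⟨j, h1⟩)
      ((hR n).stationary ⟨j, h1⟩) hX hg (fun i hi => ?_) (hK0 n) h4 h5
    have h7 : |s j ^ 2 - (Λ n j)⁻¹| ≤ g := by
      rw [abs_of_nonneg, sub_le_comm, ← one_div, le_div_iff₀ (hpos n h1)]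
      · refine le_trans ?_ (hup n h1)
        rw [mul_comm]
        exact mul_le_mul_of_nonneg_left (sub_le_sub_left h3 _) (hpos n h1).le
      · rw [sub_nonneg, inv_le_iff_one_le_mul₀ (hpos n h1)]
        exact hlow n h1
    have h8 := abs_sub_abs_le_abs_sub (s i ^ 2 - s j ^ 2) (-(s j ^ 2 - (Λ n j)⁻¹))
    rw [abs_neg, sub_neg_eq_add, sub_add_sub_cancel] at h8
    linarith [hgap i hi]
  have hdef : ∀ n, ∃ Y : H, (S Y = (s j : ℂ) • Y ∧ ‖S Y‖ = 1) ∧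
      ((∃ Y : H, S Y = (s j : ℂ) • Y ∧ ‖S Y‖ = 1 ∧
      ‖Y - X n j‖ ^ 2 ≤ 3 * (Λ n j - (s j ^ 2)⁻¹) ∧ ‖S (Y - X n j)‖ ^ 2 ≤
        8 * ((‖S‖ ^ 2 + s j ^ 2) / g) ^ 2 * K n ^ 2 * (Λ n j - (s j ^ 2)⁻¹)) →
      ‖Y - X n j‖ ^ 2 ≤ 3 * (Λ n j - (s j ^ 2)⁻¹) ∧ ‖S (Y - X n j)‖ ^ 2 ≤
        8 * ((‖S‖ ^ 2 + s j ^ 2) / g) ^ 2 * K n ^ 2 * (Λ n j - (s j ^ 2)⁻¹)) := by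
    intro n
    by_cases hex : ∃ Y : H, S Y = (s j : ℂ) • Y ∧ ‖S Y‖ = 1 ∧
      ‖Y - X n j‖ ^ 2 ≤ 3 * (Λ n j - (s j ^ 2)⁻¹) ∧ ‖S (Y - X n j)‖ ^ 2 ≤
        8 * ((‖S‖ ^ 2 + s j ^ 2) / g) ^ 2 * K n ^ 2 * (Λ n j - (s j ^ 2)⁻¹)
    · obtain ⟨Y, h1, h2, h3⟩ := hex
      exact ⟨Y, ⟨h1, h2⟩, fun _ => h3⟩
    · have h1 : S (((s j)⁻¹ : ℂ) • u j) = (s j : ℂ) • ((s j)⁻¹ : ℂ) • u j := by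
        rw [map_smul, hu, smul_comm]
      refine ⟨((s j)⁻¹ : ℂ) • u j, ⟨h1, ?_⟩, fun h => absurd h hex⟩
      rw [h1, smul_smul, mul_inv_cancel₀ (by exact_mod_cast hsj.ne'), one_smul]
      exact u.orthonormal.1 j
  choose Y hY1 hY2 using hdef
  refine ⟨Y, hY1, hvalo, ?_, ?_⟩
  · refine IsLittleO.of_pow (n := 2) ?_ two_ne_zero
    refine IsBigO.trans_isLittleO (IsBigO.of_bound 3 ?_) hvalo
    filter_upwards [hnear, hval] with n h1 h2
    simp only [Pi.pow_apply]
    rw [Real.norm_of_nonneg (by positivity), Real.norm_of_nonneg h2.1]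
    exact (hY2 n h1).1
  · refine IsBigO.trans_isLittleO (IsBigO.of_bound (8 * ((‖S‖ ^ 2 + s j ^ 2) / g) ^ 2) ?_)
      ((isBigO_refl (fun n => K n ^ 2) atTop).mul_isLittleO hvalo)
    filter_upwards [hnear, hval] with n h1 h2
    rw [Real.norm_of_nonneg (by positivity),
      Real.norm_of_nonneg (mul_nonneg (by positivity) h2.1), ← mul_assoc]
    exact (hY2 n h1).2

end RitzAsymptotics

/-! ### Harmonic Ritz pairs and the approximation by trial vectors -/

namespace PosDefOperator

variable {H : Type*} [NormedAddCommGroup H] [InnerProductSpace ℂ H] [CompleteSpace H]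
  {G : Type*} [NormedAddCommGroup G] [InnerProductSpace ℂ G] [CompleteSpace G]

theorem mem_dom_invPow (A : PosDefOperator H) (τ : ℝ) (f : H) : A.invPow τ f ∈ A.dom τ :=
  (A.mem_dom_iff _).2 ⟨f, rfl⟩

theorem mem_dom_one_inv (A : PosDefOperator H) (f : H) : A.inv f ∈ A.dom 1 :=
  A.invPow_one ▸ A.mem_dom_invPow 1 f

theorem mem_dom_half_inv (A : PosDefOperator H) (f : H) : A.inv f ∈ A.dom (1 / 2) :=
  A.inv_eq_invPow_half f ▸ A.mem_dom_invPow _ _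

theorem fpowApply_one_inv (A : PosDefOperator H) (f : H) : A.fpowApply 1 (A.inv f) = f := by
  rw [← A.invPow_one, A.fpowApply_invPow zero_le_one]

theorem inv_fpowApply_one (A : PosDefOperator H) {v : H} (hv : v ∈ A.dom 1) :
    A.inv (A.fpowApply 1 v) = v := by
  rw [← A.invPow_one, A.invPow_fpowApply zero_le_one hv]

theorem fpowApply_half_inv (A : PosDefOperator H) (f : H) :
    A.fpowApply (1 / 2) (A.inv f) = A.invPow (1 / 2) f := by
  rw [A.inv_eq_invPow_half, A.fpowApply_invPow (by norm_num)]

theorem normPow_one_inv (A : PosDefOperator H) (f : H) : A.normPow 1 (A.inv f) = ‖f‖ := by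
  rw [normPow, A.fpowApply_one_inv]

theorem normPow_half_inv (A : PosDefOperator H) (f : H) :
    A.normPow (1 / 2) (A.inv f) = ‖A.invPow (1 / 2) f‖ := by
  rw [normPow, A.fpowApply_half_inv]

/-- The trial space `span {A w_k | k < n}` of the Ritz method for `A⁻¹` in `H` that corresponds
under `A : 𝒟(A) → H` to the harmonic method with the trial vectors `w_k`. -/
noncomputable def trialSpan (A : PosDefOperator H) {n : ℕ} (w : Fin n → H) : Submodule ℂ H :=
  Submodule.span ℂ (Set.range fun k => A.fpowApply 1 (w k))

noncomputable instance hasOrthogonalProjection_trialSpan (A : PosDefOperator H) {n : ℕ} (w : Fin n → H) :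
    (A.trialSpan w).HasOrthogonalProjection :=
  hasOrthogonalProjection_span fun k => A.fpowApply 1 (w k)

theorem proj_one_inv (A : PosDefOperator H) {n : ℕ} (w : Fin n → H) (f : H) :
    A.proj 1 w (A.inv f) = A.inv ((A.trialSpan w).starProjection f) := by
  rw [proj, A.fpowApply_one_inv, A.invPow_one]
  rfl

/-- Harmonic Ritz pairs of `A` become Ritz pairs for `A^{-1/2}` under `v ↦ A v`. -/
theorem IsHarmonicRitz.isRitzSystem {A : PosDefOperator H} {n : ℕ} {w : Fin n → H}
    (hw : ∀ k, w k ∈ A.dom 1) {Λ : Fin n → ℝ} {x : Fin n → H} (h : A.IsHarmonicRitz w Λ x) :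
    (∀ i, A.inv (A.fpowApply 1 (x i)) = x i) ∧
      IsRitzSystem (A.invPow (1 / 2)) (A.trialSpan w) Λ fun i => A.fpowApply 1 (x i) := by
  obtain ⟨hmono, ⟨c, hc⟩, ho⟩ := h
  set f : Fin n → H := fun k => A.fpowApply 1 (w k) with hf
  have hfw : ∀ k, A.inv (f k) = w k := fun k => A.inv_fpowApply_one (hw k)
  have hx : ∀ i, x i = A.inv (∑ k, c i k • f k) := by
    intro i
    rw [(hc i).2, map_sum]
    exact Finset.sum_congr rfl fun k _ => by rw [map_smul, hfw]
  have hX : ∀ i, A.fpowApply 1 (x i) = ∑ k, c i k • f k := fun i => by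
    rw [hx, A.fpowApply_one_inv]
  have hinv : ∀ i, A.inv (A.fpowApply 1 (x i)) = x i := fun i => by rw [hX, ← hx]
  have hmem : ∀ i, A.fpowApply 1 (x i) ∈ A.trialSpan w := fun i => by
    rw [hX]
    exact Submodule.sum_mem _ fun k _ => Submodule.smul_mem _ _
      (Submodule.subset_span (Set.mem_range_self k))
  have hortho : ∀ i k, ⟪A.invPow (1 / 2) (A.fpowApply 1 (x i)),
      A.invPow (1 / 2) (A.fpowApply 1 (x k))⟫_ℂ = if i = k then 1 else 0 := by
    intro i k
    rw [← ho i k, innerPow, hx i, hx k]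
    simp only [A.fpowApply_half_inv, A.fpowApply_one_inv]
  refine ⟨hinv, hmono, hmem, ?_, hortho, ?_⟩
  · -- `n` orthonormal vectors in a space spanned by `n` vectors
    have hli : LinearIndependent ℂ fun i => A.fpowApply 1 (x i) := by
      have h1 : Orthonormal ℂ fun i => A.invPow (1 / 2) (A.fpowApply 1 (x i)) :=
        orthonormal_iff_ite.2 hortho
      exact LinearIndependent.of_comp (A.invPow (1 / 2) : H →ₗ[ℂ] H) h1.linearIndependent
    have hfd : FiniteDimensional ℂ (A.trialSpan w) :=
      FiniteDimensional.span_of_finite ℂ (Set.finite_range _)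
    refine (Submodule.eq_of_le_of_finrank_le (Submodule.span_le.2 ?_) ?_).ge
    · rintro _ ⟨i, rfl⟩
      exact hmem i
    · rw [finrank_span_eq_card hli]
      exact finrank_range_le_card _
  · intro i v hv
    induction hv using Submodule.span_induction with
    | mem v hv =>
      obtain ⟨k, rfl⟩ := hv
      have h1 := congrFun (hc i).1 k
      simp only [Matrix.mulVec, dotProduct, Matrix.of_apply, Pi.smul_apply, smul_eq_mul, innerPow,
        A.fpowApply_one_inv] at h1
      have h2 : ∀ y : H, ∑ l, ⟪y, A.fpowApply 1 (w l)⟫_ℂ * c i l = ⟪y, ∑ l, c i l • f l⟫_ℂ := by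
        intro y
        rw [inner_sum]
        exact Finset.sum_congr rfl fun l _ => by rw [inner_smul_right, mul_comm]
      rw [h2, h2, ← hX] at h1
      rw [h1, A.inner_invPow, ← A.inv_eq_invPow_half, ← hfw, ← A.invPow_one, A.inner_invPow]
    | zero => simp
    | add v v' _ _ h1 h2 => rw [inner_add_left, h1, h2, map_add, inner_add_left, mul_add]
    | smul a v _ h1 => rw [inner_smul_left, h1, map_smul, inner_smul_left, mul_left_comm]

/-- On the orthogonal complement of the first `n` eigenvectors, `M^{-τ}` is bounded by
`μ_n^{-τ}`. -/
theorem norm_invPow_sub_sum_le (M : PosDefOperator G) {μ : ℕ → ℝ} (e : HilbertBasis ℕ ℂ G)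
    (he : M.IsEigensystem μ e) {τ : ℝ} (hτ : 0 ≤ τ) (n : ℕ) (h : G) :
    ‖M.invPow τ (h - ∑ k ∈ Finset.range n, ⟪e k, h⟫_ℂ • e k)‖ ≤
      μ n ^ (-τ) * ‖h - ∑ k ∈ Finset.range n, ⟪e k, h⟫_ℂ • e k‖ := by
  set t := h - ∑ k ∈ Finset.range n, ⟪e k, h⟫_ℂ • e k with ht
  have hp : ∀ i, 0 ≤ μ i ^ (-τ) := fun i => Real.rpow_nonneg (he.pos i).le _
  refine le_of_sq_le_sq ?_ (mul_nonneg (hp n) (norm_nonneg _))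
  rw [mul_pow]
  refine hasSum_le (fun i => ?_) (e.hasSum_norm_inner_sq _)
    ((e.hasSum_norm_inner_sq t).mul_left _)
  rw [he.inner_invPow_right hτ, norm_mul, mul_pow, Complex.norm_real, Real.norm_of_nonneg (hp i)]
  rcases lt_or_ge i n with hi | hi
  · have h0 : ⟪e i, t⟫_ℂ = 0 := by
      rw [ht, inner_sub_right, e.orthonormal.inner_right_sum _ (Finset.mem_range.2 hi), sub_self]
    simp [h0]
  · exact mul_le_mul_of_nonneg_right (pow_le_pow_left₀ (hp i)
      (Real.rpow_le_rpow_of_nonpos (he.pos n) (he.mono hi) (neg_nonpos.2 hτ)) 2) (by positivity)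

/-- Approximation from the span of the trial vectors `J e_k`, for `v = M^{-1-τ} h`. -/
theorem norm_sub_starProjection_trialSpan_le (A : PosDefOperator H) (M : PosDefOperator G)
    (J : G →L[ℂ] H) {μ : ℕ → ℝ} (e : HilbertBasis ℕ ℂ G) (he : M.IsEigensystem μ e) {C : ℝ}
    (hC0 : 0 ≤ C) (hC : ∀ h, ∃ g, A.inv g = J (M.inv h) ∧ ‖g‖ ≤ C * ‖h‖)
    (hJe : ∀ k, J (e k) ∈ A.dom 1) {τ : ℝ} (hτ : 0 ≤ τ) (n : ℕ) {h : G} {f : H}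
    (hf : A.inv f = J (M.inv (M.invPow τ h))) :
    ‖f - (A.trialSpan fun k : Fin n => J (e k)).starProjection f‖ ≤
      C * μ n ^ (-τ) * ‖h - ∑ k ∈ Finset.range n, ⟪e k, h⟫_ℂ • e k‖ := by
  obtain ⟨g, hg, hgn⟩ := hC (M.invPow τ (h - ∑ k ∈ Finset.range n, ⟪e k, h⟫_ℂ • e k))
  have hmem : f - g ∈ A.trialSpan fun k : Fin n => J (e k) := by
    have h1 : f - g = ∑ k ∈ Finset.range n,
        (⟪e k, h⟫_ℂ * ((μ k ^ (-τ) : ℝ) : ℂ) * (((μ k)⁻¹ : ℝ) : ℂ)) • A.fpowApply 1 (J (e k)) := by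
      refine A.inv_injective ?_
      rw [map_sub, hf, hg, map_sub, map_sub, map_sub, sub_sub_cancel]
      simp only [map_sum, map_smul]
      refine Finset.sum_congr rfl fun k _ => ?_
      rw [he.invPow_apply hτ, map_smul, map_smul, he.inv_apply, map_smul, smul_smul, smul_smul,
        A.inv_fpowApply_one (hJe k), mul_assoc]
    rw [h1]
    refine Submodule.sum_mem _ fun k hk => Submodule.smul_mem _ _ (Submodule.subset_span ?_)
    exact ⟨⟨k, Finset.mem_range.1 hk⟩, rfl⟩
  refine (norm_sub_starProjection_le_of_mem _ hmem f).trans ?_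
  rw [sub_sub_cancel, mul_assoc]
  exact hgn.trans (mul_le_mul_of_nonneg_left (norm_invPow_sub_sum_le M e he hτ n h) hC0)

end PosDefOperator

theorem theorem4p6
    {H : Type*} [NormedAddCommGroup H] [InnerProductSpace ℂ H] [CompleteSpace H]
    {G : Type*} [NormedAddCommGroup G] [InnerProductSpace ℂ G] [CompleteSpace G]
    -- the identity map between the two spaces, which have the same elements and equivalent norms
    (J : G ≃L[ℂ] H)
    (A : PosDefOperator H) (M : PosDefOperator G)
    (hMcompact : IsCompactOperator M.inv)
    -- the eigenvalues and eigenvectors of `M` and of `A`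
    (μ : ℕ → ℝ) (q : ℕ → G) (hq : M.IsEigensystem μ q)
    (lam : ℕ → ℝ) (u : ℕ → H) (hu : A.IsEigensystem lam u)
    -- equality of the domains of the powers `3/2`, with equivalent norms
    (hdom : ∀ v : G, v ∈ M.dom (3 / 2) ↔ J v ∈ A.dom (3 / 2))
    (hnorm : ∃ c C : ℝ, 0 < c ∧ 0 < C ∧ ∀ v ∈ M.dom (3 / 2),
      c * M.normPow (3 / 2) v ≤ A.normPow (3 / 2) (J v) ∧
      A.normPow (3 / 2) (J v) ≤ C * M.normPow (3 / 2) v)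
    (σ : ℝ) (hσ : 1 ≤ σ) :
    -- the trial vectors lie in `𝒟(A)`
    (∀ k, J (q k) ∈ A.dom 1) ∧
    -- estimate of the projection error
    (∀ v ∈ M.dom σ, J v ∈ A.dom 1 ∧
      (∀ n : ℕ, J v - A.proj 1 (fun k : Fin n => J (q k)) (J v) ∈ A.dom (1 / 2)) ∧
      (fun n : ℕ =>
          A.normPow (1 / 2) (J v - A.proj 1 (fun k : Fin n => J (q k)) (J v)) ^ 2)
        =o[atTop] fun n : ℕ => μ n ^ (1 - 2 * σ)) ∧
    -- estimates of the harmonic Ritz values and vectors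
    (∀ ℓ : ℕ, (∀ j < ℓ, J.symm (u j) ∈ M.dom σ) →
      ∀ (Λ : ℕ → ℕ → ℝ) (x : ℕ → ℕ → H),
        (∀ n : ℕ, A.IsHarmonicRitz (fun k : Fin n => J (q k)) (fun k : Fin n => Λ n k)
          (fun k : Fin n => x n k)) →
        ∃ y : ℕ → ℕ → H, ∀ j < ℓ,
          (∀ n : ℕ, (∃ h : y n j ∈ A.op.domain, A.op ⟨y n j, h⟩ = (lam j : ℂ) • y n j) ∧
            A.normPow (1 / 2) (y n j) = 1) ∧
          (fun n : ℕ => Λ n j - lam j) =o[atTop] (fun n : ℕ => μ n ^ (2 - 2 * σ)) ∧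
          (fun n : ℕ => A.normPow 1 (y n j - x n j)) =o[atTop] (fun n : ℕ => μ n ^ (1 - σ)) ∧
          (fun n : ℕ => A.normPow (1 / 2) (y n j - x n j) ^ 2)
            =o[atTop] fun n : ℕ => μ n ^ (1 - 2 * σ)) := by
  obtain ⟨c, C₁, hc, hC₁, hcC⟩ := hnorm
  have h32 : (0 : ℝ) ≤ 3 / 2 := by norm_num
  have hMA : ∀ h, ∃ g, A.invPow (3 / 2) g = (J : G →L[ℂ] H) (M.invPow (3 / 2) h) ∧
      ‖g‖ ≤ C₁ * ‖h‖ := by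
    intro h
    have hv := M.mem_dom_invPow (3 / 2) h
    refine ⟨A.fpowApply (3 / 2) (J (M.invPow (3 / 2) h)),
      A.invPow_fpowApply h32 ((hdom _).1 hv), ?_⟩
    have h1 := (hcC _ hv).2
    rwa [PosDefOperator.normPow, PosDefOperator.normPow, M.fpowApply_invPow h32] at h1
  have hAM : ∀ g, ∃ h, (J : G →L[ℂ] H) (M.invPow (3 / 2) h) = A.invPow (3 / 2) g ∧
      ‖h‖ ≤ c⁻¹ * ‖g‖ := by
    intro g
    have hv : J.symm (A.invPow (3 / 2) g) ∈ M.dom (3 / 2) := by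
      rw [hdom, J.apply_symm_apply]
      exact A.mem_dom_invPow _ g
    refine ⟨M.fpowApply (3 / 2) (J.symm (A.invPow (3 / 2) g)), ?_, ?_⟩
    · rw [M.invPow_fpowApply h32 hv]
      exact J.apply_symm_apply _
    · have h1 := (hcC _ hv).1
      rw [PosDefOperator.normPow, PosDefOperator.normPow, J.apply_symm_apply,
        A.fpowApply_invPow h32] at h1
      rwa [inv_mul_eq_div, le_div_iff₀ hc, mul_comm]
  -- both systems of eigenvectors are orthonormal bases
  have hMc : ∀ h, M.invPow (3 / 2) h = M.inv (M.invPow (1 / 2) h) := fun h => by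
    rw [← M.invPow_one, ← M.invPow_add zero_le_one (by norm_num)]
    norm_num
  have hMcomp : IsCompactOperator (M.invPow (3 / 2)) := by
    have h1 := hMcompact.comp_clm (M.invPow (1 / 2))
    exact (funext hMc : ⇑(M.invPow (3 / 2)) = M.inv ∘ M.invPow (1 / 2)) ▸ h1
  have hAcomp : IsCompactOperator (A.invPow (3 / 2)) :=
    isCompactOperator_of_forall_exists ((J : G →L[ℂ] H).comp (M.invPow (3 / 2)))
      (hMcomp.clm_comp (J : G →L[ℂ] H)) (A.invPow (3 / 2)) hAM
  obtain ⟨e, rfl⟩ : ∃ e : HilbertBasis ℕ ℂ G, q = e :=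
    ⟨hq.hilbertBasis (by norm_num) hMcomp, funext fun k => (hq.hilbertBasis_apply _ _ k).symm⟩
  obtain ⟨u, rfl⟩ : ∃ b : HilbertBasis ℕ ℂ H, u = b :=
    ⟨hu.hilbertBasis (by norm_num) hAcomp, funext fun k => (hu.hilbertBasis_apply _ _ k).symm⟩
  have hμ : ∀ n, 0 < μ n := hq.pos
  have hlam : ∀ i, 0 < lam i := hu.pos
  obtain ⟨C, hC0, hC'⟩ := A.exists_invPow_eq_of_le M (J : G →L[ℂ] H) e u hq hu
    (by norm_num) zero_le_one (by norm_num) hMA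
  have hC : ∀ h, ∃ g, A.inv g = (J : G →L[ℂ] H) (M.inv h) ∧ ‖g‖ ≤ C * ‖h‖ := by
    rwa [A.invPow_one, M.invPow_one] at hC'
  have hJdom : ∀ h : G, J (M.inv h) ∈ A.dom 1 := fun h => by
    obtain ⟨g, hg, -⟩ := hC h
    exact (show A.inv g = J (M.inv h) from hg) ▸ A.mem_dom_one_inv g
  have hJe : ∀ k, J (e k) ∈ A.dom 1 := by
    intro k
    have h1 := hJdom ((μ k : ℂ) • e k)
    rwa [map_smul, hq.inv_apply, smul_smul, ← Complex.ofReal_mul, mul_inv_cancel₀ (hμ k).ne',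
      Complex.ofReal_one, one_smul] at h1
  set S := A.invPow (1 / 2) with hSdef
  have hS : ∀ x y, ⟪S x, y⟫_ℂ = ⟪x, S y⟫_ℂ := A.inner_invPow _
  let V : ℕ → Submodule ℂ H := fun n => A.trialSpan fun k : Fin n => J (e k)
  have hVinst : ∀ n, (V n).HasOrthogonalProjection := fun n =>
    inferInstanceAs (A.trialSpan fun k : Fin n => J (e k)).HasOrthogonalProjection
  have happrox : ∀ {τ : ℝ}, 0 ≤ τ → ∀ (n : ℕ) {h : G} {f : H},
      A.inv f = J (M.inv (M.invPow τ h)) → ‖f - (V n).starProjection f‖ ≤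
        C * μ n ^ (-τ) * ‖h - ∑ k ∈ Finset.range n, ⟪e k, h⟫_ℂ • e k‖ := fun hτ n h f hf =>
    A.norm_sub_starProjection_trialSpan_le M (J : G →L[ℂ] H) e hq hC0 hC hJe hτ n hf
  -- the constants of duality
  set K : ℕ → ℝ := fun n => C * c⁻¹ * μ n ^ (-(1 / 2) : ℝ) with hKdef
  have hK0 : ∀ n, 0 ≤ K n := fun n =>
    mul_nonneg (mul_nonneg hC0 (inv_nonneg.2 hc.le)) (Real.rpow_nonneg (hμ n).le _)
  have hK : ∀ n g, ‖S g - (V n).starProjection (S g)‖ ≤ K n * ‖g‖ := by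
    intro n g
    obtain ⟨h, hh, hhn⟩ := hAM g
    have h1 : A.inv (S g) = J (M.inv (M.invPow (1 / 2) h)) := by
      rw [← hMc, ← A.invPow_one, hSdef, ← A.invPow_add zero_le_one (by norm_num)]
      refine Eq.trans ?_ hh.symm
      norm_num
    refine (happrox (by norm_num) n h1).trans ?_
    calc _ ≤ C * μ n ^ (-(1 / 2) : ℝ) * (c⁻¹ * ‖g‖) := mul_le_mul_of_nonneg_left
          ((e.norm_sub_sum_range_le n h).trans hhn)
          (mul_nonneg hC0 (Real.rpow_nonneg (hμ n).le _))
      _ = _ := by rw [hKdef]; ring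
  have hKlim : Tendsto K atTop (nhds 0) := by
    have h1 := (tendsto_rpow_neg_atTop (y := 1 / 2) (by norm_num)).comp
      (hq.tendsto_atTop hMcompact)
    rw [← mul_zero (C * c⁻¹)]
    exact h1.const_mul (C * c⁻¹)
  have hK2 : ∀ n, K n ^ 2 * (μ n ^ (1 - σ)) ^ 2 = (C * c⁻¹) ^ 2 * μ n ^ (1 - 2 * σ) := by
    intro n
    rw [hKdef]
    simp only
    rw [mul_pow, mul_assoc, ← Real.rpow_mul_natCast (hμ n).le, ← Real.rpow_mul_natCast (hμ n).le,
      ← Real.rpow_add (hμ n)]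
    congr 2
    push_cast
    ring
  -- the error of the projection in `ℋ_1`
  have hproj : ∀ {v : G}, v ∈ M.dom σ → ∃ f, A.inv f = J v ∧
      (fun n => ‖f - (V n).starProjection f‖) =o[atTop] fun n => μ n ^ (1 - σ) := by
    intro v hv
    obtain ⟨h, rfl⟩ := (M.mem_dom_iff v).1 hv
    have h1 : M.invPow σ h = M.inv (M.invPow (σ - 1) h) := by
      rw [← M.invPow_one, ← M.invPow_add zero_le_one (sub_nonneg.2 hσ), add_sub_cancel]
    obtain ⟨f, hf, -⟩ := hC (M.invPow (σ - 1) h)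
    have hf' : A.inv f = J (M.inv (M.invPow (σ - 1) h)) := hf
    refine ⟨f, h1 ▸ hf', ?_⟩
    have htail : Tendsto (fun n => ‖h - ∑ k ∈ Finset.range n, ⟪e k, h⟫_ℂ • e k‖) atTop
        (nhds 0) := by
      have h2 := ((tendsto_const_nhds (x := h)).sub (e.tendsto_sum_range h)).norm
      simpa using h2
    have h3 : (fun n => ‖h - ∑ k ∈ Finset.range n, ⟪e k, h⟫_ℂ • e k‖ * μ n ^ (1 - σ)) =o[atTop]
        fun n => μ n ^ (1 - σ) := by
      simpa using ((isLittleO_one_iff ℝ).2 htail).mul_isBigO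
        (isBigO_refl (fun n => μ n ^ (1 - σ)) atTop)
    refine IsBigO.trans_isLittleO (IsBigO.of_bound C (Eventually.of_forall fun n => ?_)) h3
    rw [norm_norm, Real.norm_of_nonneg
      (mul_nonneg (norm_nonneg _) (Real.rpow_nonneg (hμ n).le _))]
    refine (happrox (sub_nonneg.2 hσ) n hf').trans_eq ?_
    rw [neg_sub]
    ring
  refine ⟨hJe, fun v hv => ?_, fun ℓ hℓ Λ x hRitz => ?_⟩
  · obtain ⟨f, hf, hfo⟩ := hproj hv
    have he : ∀ n : ℕ, J v - A.proj 1 (fun k : Fin n => J (e k)) (J v) =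
        A.inv (f - (V n).starProjection f) := by
      intro n
      rw [← hf, A.proj_one_inv, ← map_sub]
    refine ⟨hf ▸ A.mem_dom_one_inv f, fun n => he n ▸ A.mem_dom_half_inv _, ?_⟩
    have h1 : (fun n => K n ^ 2 * ‖f - (V n).starProjection f‖ ^ 2) =o[atTop]
        fun n => μ n ^ (1 - 2 * σ) := by
      refine IsLittleO.trans_isBigO ((isBigO_refl (fun n => K n ^ 2) atTop).mul_isLittleO
        (hfo.pow two_pos)) ?_
      simp only [hK2]
      exact isBigO_const_mul_self _ _ _
    refine IsBigO.trans_isLittleO (IsBigO.of_bound 1 (Eventually.of_forall fun n => ?_)) h1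
    rw [he, A.normPow_half_inv, one_mul, Real.norm_of_nonneg (by positivity),
      Real.norm_of_nonneg (by positivity), ← mul_pow]
    exact pow_le_pow_left₀ (norm_nonneg _) (norm_apply_sub_starProjection_le (V n) hS (hK n) f) 2
  · set s : ℕ → ℝ := fun i => lam i ^ (-(1 / 2) : ℝ) with hsdef
    have hs : ∀ i, 0 < s i := fun i => Real.rpow_pos_of_pos (hlam i) _
    have hanti : Antitone s := fun i j hij =>
      Real.rpow_le_rpow_of_nonpos (hlam i) (hu.mono hij) (by norm_num)
    have hs2 : ∀ i, (s i ^ 2)⁻¹ = lam i := fun i => by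
      rw [hsdef]
      simp only
      rw [← Real.rpow_mul_natCast (hlam i).le, ← Real.rpow_neg (hlam i).le]
      norm_num
    have hus : ∀ i, S (u i) = (s i : ℂ) • u i := hu.invPow_apply (by norm_num)
    have hR := fun n => (hRitz n).isRitzSystem fun k => hJe k
    have hr : (fun n => μ n ^ (1 - σ)) =O[atTop] fun _ => (1 : ℝ) := by
      refine IsBigO.of_bound (μ 0 ^ (1 - σ)) (Eventually.of_forall fun n => ?_)
      rw [norm_one, mul_one, Real.norm_of_nonneg (Real.rpow_nonneg (hμ n).le _)]
      exact Real.rpow_le_rpow_of_nonpos (hμ 0) (hq.mono (Nat.zero_le n)) (sub_nonpos.2 hσ)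
    have herr : ∀ j < ℓ, (fun n => ‖u j - (V n).starProjection (u j)‖) =o[atTop]
        fun n => μ n ^ (1 - σ) := by
      intro j hj
      obtain ⟨f, hf, hfo⟩ := hproj (hℓ j hj)
      have h1 : f = (lam j : ℂ) • u j := by
        refine A.inv_injective ?_
        rw [hf, J.apply_symm_apply, map_smul, hu.inv_apply, smul_smul, ← Complex.ofReal_mul,
          mul_inv_cancel₀ (hlam j).ne', Complex.ofReal_one, one_smul]
      have h2 : ∀ n, ‖f - (V n).starProjection f‖ =
          lam j * ‖u j - (V n).starProjection (u j)‖ := fun n => by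
        rw [h1, map_smul, ← smul_sub, norm_smul, Complex.norm_real,
          Real.norm_of_nonneg (hlam j).le]
      simp only [h2] at hfo
      exact (isLittleO_const_mul_left_iff (hlam j).ne').1 hfo
    have hY := fun j (hj : j < ℓ) => exists_eigenvector_isLittleO hS hus hs hanti V
      (X := fun n k => A.fpowApply 1 (x n k)) (fun n => (hR n).2) hK hK0 hKlim hr j
      fun i hi => herr i (hi.trans_lt hj)
    choose! Y hY1 hY2 hY3 hY4 using hY
    refine ⟨fun n j => A.inv (Y j n), fun j hj => ⟨fun n => ⟨?_, ?_⟩, ?_, ?_, ?_⟩⟩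
    · refine A.op_eq_of_inv_eq (hlam j).ne' ?_
      have h1 : A.inv (Y j n) = (((lam j)⁻¹ : ℝ) : ℂ) • Y j n := by
        have h2 := (hY1 j hj n).1
        rw [A.inv_eq_invPow_half, ← hSdef, h2, map_smul, h2, smul_smul, ← Complex.ofReal_mul,
          ← hs2 j, inv_inv, pow_two]
      simp only [h1, map_smul]
    · rw [A.normPow_half_inv]
      exact (hY1 j hj n).2
    · refine (hY2 j hj).congr (fun n => by rw [hs2]) fun n => ?_
      rw [← Real.rpow_mul_natCast (hμ n).le]
      congr 1
      push_cast
      ring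
    · refine (hY3 j hj).congr' ?_ EventuallyEq.rfl
      filter_upwards [eventually_gt_atTop j] with n hn
      rw [← (hR n).1 ⟨j, hn⟩, ← map_sub, A.normPow_one_inv, A.fpowApply_one_inv]
    · refine IsLittleO.trans_isBigO (g := fun n => K n ^ 2 * (μ n ^ (1 - σ)) ^ 2) ?_ ?_
      · refine (hY4 j hj).congr' ?_ EventuallyEq.rfl
        filter_upwards [eventually_gt_atTop j] with n hn
        rw [← (hR n).1 ⟨j, hn⟩, ← map_sub, A.normPow_half_inv, A.fpowApply_one_inv]
      · simp only [hK2]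
        exact isBigO_const_mul_self _ _ _
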